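/- Let $V\in C^2(\mathbb R^d)$ be such that $d\mu = e^{-V(x)}\,dx$ is a probability measure on $\mathbb R^d$. Let $p\in[1,2)$ and let $p'=p/(p-1)\in(2,\infty]$ be its Hölder conjugate ($p'=\infty$ if $p=1$). Suppose that there is $\sigma\in(0,\infty)$ such that $$V-\frac{|x|^2}{2\sigma^2}\in L^{p'}(d\nu_\sigma)\qquad\text{and}\qquad \inf_{x\in\mathbb R^d}\Big(|\nabla V|^2-2\Delta V-\frac{|x|^2}{\sigma^4}\Big)>-\infty ,$$ where $d\nu_\sigma(x)=(2\pi\sigma^2)^{-d/2}e^{-|x|^2/(2\sigma^2)}\,dx$. Let $H^1(\mu)$ be the set of real functions $u\in L^2(\mu)$ whose weak gradient $\nabla u$ is in $L^2(\mu)$. If $p=1$, then $\mu$ satisfies the logarithmic Sobolev inequality: there is a finite constant $C_1$ such that, for all $u\in H^1(\mu)$, the function $u^2\log\big(u^2/\|u\|_{L^2(\mu)}^2\big)$ is $\mu$-integrable and $$\int u^2\log\Big(\frac{u^2}{\|u\|_{L^2(\mu)}^2}\Big)\,d\mu\le C_1\int|\nabla u|^2\,d\mu .$$ If $1<p<2$,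 then $\mu$ satisfies the generalized Poincaré inequality with exponent $p$: there is a finite constant $C_p$ such that, for all $u\in H^1(\mu)$, $$\frac1{p-1}\left[\int|u|^2\,d\mu-\Big(\int|u|^{2/p}\,d\mu\Big)^p\right]\le C_p\int|\nabla u|^2\,d\mu .$$ -/

import Mathlib

open MeasureTheory InnerProductSpace Gradient
open scoped ENNReal ContDiff Laplacian

noncomputable section

namespace ConvexSobolev

/-- The measure `e^{-V(x)} dx` on `ℝ^d`. -/
def expNeg {d : ℕ} (V : EuclideanSpace ℝ (Fin d) → ℝ) : Measure (EuclideanSpace ℝ (Fin d)) :=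
  volume.withDensity (fun x => ENNReal.ofReal (Real.exp (-V x)))

/-- The centred Gaussian measure `ν_σ` on `ℝ^d`, with density
`(2πσ²)^{-d/2} e^{-|x|²/(2σ²)}`. -/
def gaussian (d : ℕ) (σ : ℝ) : Measure (EuclideanSpace ℝ (Fin d)) :=
  volume.withDensity (fun x => ENNReal.ofReal
    ((2 * Real.pi * σ ^ 2) ^ (-(d : ℝ) / 2) * Real.exp (-‖x‖ ^ 2 / (2 * σ ^ 2))))

/-- `G` is the weak (distributional) gradient of `u` on `ℝ^d`:
`∫ u ∂_e φ dx = -∫ ⟨G, e⟩ φ dx` for every smooth compactly supported `φ` and every direction `e`. -/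
structure IsWeakGradient {d : ℕ} (u : EuclideanSpace ℝ (Fin d) → ℝ)
    (G : EuclideanSpace ℝ (Fin d) → EuclideanSpace ℝ (Fin d)) : Prop where
  locallyIntegrable : LocallyIntegrable u volume
  locallyIntegrable_grad : LocallyIntegrable G volume
  integral_eq : ∀ φ : EuclideanSpace ℝ (Fin d) → ℝ, ContDiff ℝ ∞ φ → HasCompactSupport φ →
    ∀ e : EuclideanSpace ℝ (Fin d),
      ∫ x, u x * fderiv ℝ φ x e = -∫ x, inner ℝ (G x) e * φ x

/-- `u` belongs to the weighted Sobolev space `H¹(μ)` and `G = ∇u`: both `u` and its weak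
gradient `G` are square integrable with respect to `μ`. -/
structure MemH1 {d : ℕ} (μ : Measure (EuclideanSpace ℝ (Fin d)))
    (u : EuclideanSpace ℝ (Fin d) → ℝ)
    (G : EuclideanSpace ℝ (Fin d) → EuclideanSpace ℝ (Fin d)) : Prop where
  isWeakGradient : IsWeakGradient u G
  memLp : MemLp u 2 μ
  memLp_grad : MemLp G 2 μ

/-- The (tight) logarithmic Sobolev inequality for `μ`, with some finite constant:
`∫ u² log(u² / ‖u‖²_{L²(μ)}) dμ ≤ C ∫ |∇u|² dμ` for all `u ∈ H¹(μ)`.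
The finiteness of the left-hand side is part of the claim. -/
def LogSobolev {d : ℕ} (μ : Measure (EuclideanSpace ℝ (Fin d))) : Prop :=
  ∃ C : ℝ, ∀ u G, MemH1 μ u G →
    Integrable (fun x => u x ^ 2 * Real.log (u x ^ 2 / ∫ y, u y ^ 2 ∂μ)) μ ∧
    ∫ x, u x ^ 2 * Real.log (u x ^ 2 / ∫ y, u y ^ 2 ∂μ) ∂μ ≤ C * ∫ x, ‖G x‖ ^ 2 ∂μ

/-- The generalized Poincaré (convex Sobolev) inequality for `μ` with exponent `p ∈ (1, 2]`,
with some finite constant: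
`(1/(p-1)) [∫ |u|² dμ - (∫ |u|^{2/p} dμ)^p] ≤ C ∫ |∇u|² dμ` for all `u ∈ H¹(μ)`. -/
def GeneralizedPoincare {d : ℕ} (p : ℝ) (μ : Measure (EuclideanSpace ℝ (Fin d))) : Prop :=
  ∃ C : ℝ, ∀ u G, MemH1 μ u G →
    1 / (p - 1) * ((∫ x, |u x| ^ 2 ∂μ) - (∫ x, |u x| ^ (2 / p) ∂μ) ^ p) ≤
      C * ∫ x, ‖G x‖ ^ 2 ∂μ

end ConvexSobolev

end

set_option linter.unusedSectionVars false

namespace ConvexSobolev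

open Filter Topology Set
open scoped Convolution

/-! Write Q = (|∇V|² - 2ΔV)/4. The substitution w = u e^{-V/2} (ground state transform) gives ∫|∇w|²
dx = ∫|∇u|² dμ - ∫ u² Q dμ, so ∫ u² Q dμ ≤ ∫|∇u|² dμ. The second hypothesis says Q ≥ |x|²/(4σ⁴) -
const: the Dirichlet form confines mass. Outside a large ball this controls u², and inside it V is
bounded, so the Euclidean Poincaré inequality on a ball transfers to μ. Together they give a
Poincaré inequality for μ (`exists_poincare`). For 1 < p < 2, Jensen gives (∫|u|^{2/p})^p ≥ (∫u)²,
so the bracket is at most the variance and the generalized inequality follows.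

For p = 1, V - |x|²/(2σ²) is bounded above, hence V ≤ 2σ² Q + const. Sobolev's inequality implies a
Euclidean logarithmic Sobolev inequality whose gradient constant A may be prescribed
(`exists_euclidean_logSobolev`). Applied to w with A = 2σ², it produces the error ∫ u² V dμ from log
w² and the gain -A ∫ u² Q dμ from |∇w|²; the gain absorbs the error up to a multiple of ∫u² dμ. This
is a defective inequality for μ. Comparing u with its mean and using the Poincaré inequality removes
the defect (`logSobolev_of_defective_of_poincare`).

The form identities are proved for compactly supported functions, so density of these in H¹(μ)
(`MemH1.exists_seq_tendsto`) is used throughout. -/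

theorem eLpNorm_two_sq {α F : Type*} [MeasurableSpace α] [NormedAddCommGroup F] (f : α → F)
    (μ : Measure α) : eLpNorm f 2 μ ^ 2 = ∫⁻ x, ‖f x‖ₑ ^ 2 ∂μ := by
  have h := eLpNorm_nnreal_pow_eq_lintegral (μ := μ) (f := f) (p := 2) (by norm_num)
  simpa only [NNReal.coe_ofNat, ENNReal.coe_ofNat, ENNReal.rpow_two] using h

/-! ### Mollification in unweighted L² -/

section Mollification

variable {E : Type*} [NormedAddCommGroup E] [InnerProductSpace ℝ E] [FiniteDimensional ℝ E]
  [MeasurableSpace E] [BorelSpace E]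
  {F : Type*} [NormedAddCommGroup F] [NormedSpace ℝ F]

/-- Translations act continuously on `Lp` for finite exponents; this is the orbit map of f at 0. -/
theorem tendsto_eLpNorm_translate_sub {f : E → F} (hf : MemLp f 2 volume) :
    Tendsto (fun y : E => eLpNorm (fun x => f (x - y) - f x) 2 volume) (𝓝 0) (𝓝 0) := by
  have : Fact ((2 : ℝ≥0∞) ≠ ⊤) := ⟨by norm_num⟩
  have hc : Continuous fun y : E => DomAddAct.mk (-y) +ᵥ hf.toLp f := by
    have : Continuous fun y : E => DomAddAct.mk (-y) :=
      DomAddAct.continuous_mk.comp continuous_neg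
    exact this.vadd continuous_const
  have h := hc.tendsto 0
  rw [neg_zero, DomAddAct.mk_zero, zero_vadd] at h
  have h2 := (tendsto_iff_edist_tendsto_0.1 h)
  refine h2.congr fun y => ?_
  rw [DomAddAct.mk_vadd_toLp, Lp.edist_toLp_toLp]
  congr 1
  ext x
  simp [sub_eq_neg_add]

/-- Averaging the translates of `f` against a probability density moves `f` in `L²` by at most
the largest displacement of a translate. -/
theorem eLpNorm_convolution_sub_le [CompleteSpace F] {f : E → F} (hf : MemLp f 2 volume)
    {ρ : E → ℝ} (hρc : Continuous ρ) (hρs : HasCompactSupport ρ) (hρ0 : ∀ t, 0 ≤ ρ t)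
    (hρ1 : ∫ t, ρ t = 1) {δ : ℝ≥0∞}
    (hδ : ∀ t, ρ t ≠ 0 → eLpNorm (fun x => f (x - t) - f x) 2 volume ≤ δ) :
    eLpNorm (fun x => (ρ ⋆[ContinuousLinearMap.lsmul ℝ ℝ, volume] f) x - f x) 2 volume ≤ δ := by
  have hρi : Integrable ρ volume := hρc.integrable_of_hasCompactSupport hρs
  have hloc : LocallyIntegrable f volume := hf.locallyIntegrable (by norm_num)
  -- As ρ(t) dt is a probability measure, the L¹(P) norm is at most the L²(P) norm; with Tonelli
  -- this replaces Minkowski's integral inequality.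
  set P : Measure E := volume.withDensity fun t => ENNReal.ofReal (ρ t) with hP
  have hρm : Measurable fun t => ENNReal.ofReal (ρ t) := hρc.measurable.ennreal_ofReal
  have hP1 : P univ = 1 := by
    rw [hP, withDensity_apply _ MeasurableSet.univ, Measure.restrict_univ,
      ← ofReal_integral_eq_lintegral_ofReal hρi (ae_of_all _ hρ0), hρ1, ENNReal.ofReal_one]
  have : IsProbabilityMeasure P := ⟨hP1⟩
  have hPac : P ≪ volume := withDensity_absolutelyContinuous _ _
  have hq : Measure.QuasiMeasurePreserving (fun p : E × E => p.1 - p.2)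
      (volume.prod volume) volume := quasiMeasurePreserving_sub_of_right_invariant volume volume
  have hm : AEStronglyMeasurable (fun p : E × E => f (p.1 - p.2) - f p.1)
      (volume.prod volume) :=
    (hf.1.comp_quasiMeasurePreserving hq).sub hf.1.comp_fst
  have hm2 : ∀ x, AEStronglyMeasurable (fun t : E => f (x - t) - f x) P := fun x =>
    ((hf.1.comp_quasiMeasurePreserving
      (quasiMeasurePreserving_sub_left_of_right_invariant volume x)).sub
      aestronglyMeasurable_const).mono_ac hPac
  have key : ∀ x, ‖(ρ ⋆[ContinuousLinearMap.lsmul ℝ ℝ, volume] f) x - f x‖ₑ ^ 2 ≤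
      ∫⁻ t, ‖f (x - t) - f x‖ₑ ^ 2 ∂P := by
    intro x
    have hce : Integrable (fun t => ρ t • f (x - t)) volume :=
      hρs.convolutionExists_left (ContinuousLinearMap.lsmul ℝ ℝ) hρc hloc x
    have e1 : (ρ ⋆[ContinuousLinearMap.lsmul ℝ ℝ, volume] f) x - f x =
        ∫ t, ρ t • (f (x - t) - f x) := by
      simp_rw [smul_sub]
      rw [integral_sub hce (hρi.smul_const _), integral_smul_const, hρ1, one_smul]
      rfl
    have e2 : ‖(ρ ⋆[ContinuousLinearMap.lsmul ℝ ℝ, volume] f) x - f x‖ₑ ≤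
        ∫⁻ t, ‖f (x - t) - f x‖ₑ ∂P := by
      rw [e1]
      refine (enorm_integral_le_lintegral_enorm _).trans_eq ?_
      rw [hP, lintegral_withDensity_eq_lintegral_mul_non_measurable _ hρm
        (ae_of_all _ fun _ => ENNReal.ofReal_lt_top)]
      refine lintegral_congr fun t => ?_
      simp [enorm_smul, Real.enorm_of_nonneg (hρ0 t)]
    have e3 := eLpNorm_le_eLpNorm_of_exponent_le (p := 1) (q := 2) (by norm_num) (hm2 x)
    rw [eLpNorm_one_eq_lintegral_enorm] at e3
    calc _ ≤ (eLpNorm (fun t : E => f (x - t) - f x) 2 P) ^ 2 := by gcongr; exact e2.trans e3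
      _ = _ := eLpNorm_two_sq _ _
  rw [← ENNReal.pow_le_pow_left_iff two_ne_zero, eLpNorm_two_sq]
  calc _ ≤ ∫⁻ x, ∫⁻ t, ‖f (x - t) - f x‖ₑ ^ 2 ∂P := lintegral_mono key
    _ = ∫⁻ x, ∫⁻ t, ENNReal.ofReal (ρ t) * ‖f (x - t) - f x‖ₑ ^ 2 := by
        simp_rw [hP, lintegral_withDensity_eq_lintegral_mul_non_measurable _ hρm
          (ae_of_all _ fun _ => ENNReal.ofReal_lt_top), Pi.mul_apply]
    _ = ∫⁻ t, ∫⁻ x, ENNReal.ofReal (ρ t) * ‖f (x - t) - f x‖ₑ ^ 2 :=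
        lintegral_lintegral_swap ((hρm.comp measurable_snd).aemeasurable.mul (hm.enorm.pow_const 2))
    _ = ∫⁻ t, ENNReal.ofReal (ρ t) * eLpNorm (fun x => f (x - t) - f x) 2 volume ^ 2 := by
        refine lintegral_congr fun t => ?_
        rw [lintegral_const_mul' _ _ ENNReal.ofReal_ne_top, eLpNorm_two_sq]
    _ ≤ ∫⁻ t, ENNReal.ofReal (ρ t) * δ ^ 2 := by
        refine lintegral_mono fun t => ?_
        by_cases h : ρ t = 0
        · simp [h]
        · exact mul_le_mul_right (pow_le_pow_left' (hδ t h) 2) _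
    _ = δ ^ 2 := by
        rw [lintegral_mul_const _ hρm, ← ofReal_integral_eq_lintegral_ofReal hρi
          (ae_of_all _ hρ0), hρ1, ENNReal.ofReal_one, one_mul]

theorem tendsto_eLpNorm_convolution_sub [CompleteSpace F] {f : E → F} (hf : MemLp f 2 volume)
    {ι : Type*} {l : Filter ι} {φ : ι → ContDiffBump (0 : E)}
    (hφ : Tendsto (fun i => (φ i).rOut) l (𝓝 0)) :
    Tendsto (fun i => eLpNorm (fun x =>
      ((φ i).normed volume ⋆[ContinuousLinearMap.lsmul ℝ ℝ, volume] f) x - f x) 2 volume) l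
      (𝓝 0) := by
  rw [ENNReal.tendsto_nhds_zero]
  intro δ hδ
  have h := (ENNReal.tendsto_nhds_zero.1 (tendsto_eLpNorm_translate_sub hf)) δ hδ
  obtain ⟨r, hr, hb⟩ := Metric.eventually_nhds_iff_ball.1 h
  filter_upwards [hφ.eventually_lt_const hr] with i hi
  refine eLpNorm_convolution_sub_le hf (φ i).continuous_normed (φ i).hasCompactSupport_normed
    (φ i).nonneg_normed (φ i).integral_normed fun t ht => hb t ?_
  have : t ∈ Function.support ((φ i).normed volume) := ht
  rw [ContDiffBump.support_normed_eq] at this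
  exact Metric.ball_subset_ball hi.le this

end Mollification

/-! ### Weak gradients under mollification -/

section WeakGradient

variable {d : ℕ}

theorem IsWeakGradient.contDiff_convolution {u : EuclideanSpace ℝ (Fin d) → ℝ}
    {G : EuclideanSpace ℝ (Fin d) → EuclideanSpace ℝ (Fin d)} (h : IsWeakGradient u G)
    {ρ : EuclideanSpace ℝ (Fin d) → ℝ} (hρ : ContDiff ℝ ∞ ρ) (hρs : HasCompactSupport ρ) :
    ContDiff ℝ ∞ (ρ ⋆[ContinuousLinearMap.lsmul ℝ ℝ, volume] u) :=
  hρs.contDiff_convolution_left _ hρ h.locallyIntegrable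

/-- The gradient of a mollification is the mollification of the weak gradient. -/
theorem IsWeakGradient.gradient_convolution {u : EuclideanSpace ℝ (Fin d) → ℝ}
    {G : EuclideanSpace ℝ (Fin d) → EuclideanSpace ℝ (Fin d)} (h : IsWeakGradient u G)
    {ρ : EuclideanSpace ℝ (Fin d) → ℝ} (hρ : ContDiff ℝ ∞ ρ) (hρs : HasCompactSupport ρ)
    (x : EuclideanSpace ℝ (Fin d)) :
    ∇ (ρ ⋆[ContinuousLinearMap.lsmul ℝ ℝ, volume] u) x =
      (ρ ⋆[ContinuousLinearMap.lsmul ℝ ℝ, volume] G) x := by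
  have hρ1 : ContDiff ℝ 1 ρ := hρ.of_le (by simp)
  have hd := hρs.hasFDerivAt_convolution_left (ContinuousLinearMap.lsmul ℝ ℝ) hρ1
    h.locallyIntegrable x
  have hint : Integrable (fun t => ρ t • G (x - t)) volume :=
    hρs.convolutionExists_left (ContinuousLinearMap.lsmul ℝ ℝ) hρ.continuous
      h.locallyIntegrable_grad x
  have hint2 := (hρs.fderiv ℝ).convolutionExists_left
    ((ContinuousLinearMap.lsmul ℝ ℝ).precompL (EuclideanSpace ℝ (Fin d)))
    (hρ1.continuous_fderiv one_ne_zero) h.locallyIntegrable x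
  refine ext_inner_right ℝ fun e => ?_
  rw [inner_gradient_left, hd.fderiv]
  have e1 : ((fderiv ℝ ρ ⋆[(ContinuousLinearMap.lsmul ℝ ℝ).precompL
      (EuclideanSpace ℝ (Fin d)), volume] u) x) e = ∫ t, fderiv ℝ ρ t e * u (x - t) := by
    rw [convolution_def, ContinuousLinearMap.integral_apply hint2]
    rfl
  have e2 : inner ℝ ((ρ ⋆[ContinuousLinearMap.lsmul ℝ ℝ, volume] G) x) e =
      ∫ t, inner ℝ (G (x - t)) e * ρ t := by
    rw [convolution_def, real_inner_comm]
    refine (integral_inner hint e).symm.trans ?_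
    refine integral_congr_ae (ae_of_all _ fun t => ?_)
    simp only [inner_smul_right]
    rw [real_inner_comm, mul_comm]
  -- The reflected kernel is the test function; the sign from reflection cancels the one in the
  -- definition of the weak gradient.
  have hφ : ContDiff ℝ ∞ fun y => ρ (x - y) := hρ.comp (contDiff_const.sub contDiff_id)
  have hφs : HasCompactSupport fun y => ρ (x - y) :=
    hρs.comp_homeomorph (Homeomorph.subLeft x)
  have hw := h.integral_eq _ hφ hφs e
  have hfd : ∀ y, fderiv ℝ (fun y => ρ (x - y)) y e = - fderiv ℝ ρ (x - y) e := fun y => by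
    have h1 : HasFDerivAt (fun y => x - y)
        (-ContinuousLinearMap.id ℝ (EuclideanSpace ℝ (Fin d))) y := (hasFDerivAt_id y).const_sub x
    have h2 : HasFDerivAt (fun y => ρ (x - y)) _ y :=
      ((hρ1.differentiable one_ne_zero) (x - y)).hasFDerivAt.comp y h1
    rw [h2.fderiv]
    simp
  simp_rw [hfd, mul_neg, integral_neg, neg_inj] at hw
  rw [e1, e2, ← integral_sub_left_eq_self _ volume x,
    ← integral_sub_left_eq_self (fun t => inner ℝ (G (x - t)) e * ρ t) volume x]
  simp only [sub_sub_cancel]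
  rw [← hw]
  exact integral_congr_ae (ae_of_all _ fun t => mul_comm _ _)

end WeakGradient

/-! ### Local smooth approximation in H¹(μ) -/

section Density

variable {d : ℕ} {V : EuclideanSpace ℝ (Fin d) → ℝ}

/-- If |V| ≤ M on the ball, the density lies between e^{-M} and e^M, so c = e^M serves in both
directions. -/
theorem exists_expNeg_restrict_le (hV : Continuous V) (R : ℝ) :
    ∃ c : ℝ≥0∞, c ≠ ⊤ ∧ c ≠ 0 ∧
      (expNeg V).restrict (Metric.closedBall 0 R) ≤ c • volume.restrict (Metric.closedBall 0 R) ∧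
      volume.restrict (Metric.closedBall 0 R) ≤
        c • (expNeg V).restrict (Metric.closedBall 0 R) := by
  obtain ⟨M, hM⟩ := (isCompact_closedBall (0 : EuclideanSpace ℝ (Fin d)) R).exists_bound_of_continuousOn
    hV.continuousOn
  have hm : Measurable fun x => ENNReal.ofReal (Real.exp (-V x)) :=
    (Real.continuous_exp.comp hV.neg).measurable.ennreal_ofReal
  have hB : MeasurableSet (Metric.closedBall (0 : EuclideanSpace ℝ (Fin d)) R) :=
    measurableSet_closedBall
  refine ⟨ENNReal.ofReal (Real.exp M), ENNReal.ofReal_ne_top, by simp [Real.exp_pos], ?_, ?_⟩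
  · rw [expNeg, restrict_withDensity hB, ← withDensity_const]
    refine withDensity_mono ?_
    filter_upwards [ae_restrict_mem hB] with x hx
    have := (abs_le.1 (hM x hx)).1
    exact ENNReal.ofReal_le_ofReal (Real.exp_le_exp.2 (by linarith))
  · rw [expNeg, restrict_withDensity hB, ← withDensity_smul _ hm]
    conv_lhs => rw [← withDensity_one (μ := volume.restrict (Metric.closedBall 0 R))]
    refine withDensity_mono ?_
    filter_upwards [ae_restrict_mem hB] with x hx
    have := (abs_le.1 (hM x hx)).2
    simp only [Pi.one_apply, Pi.smul_apply, smul_eq_mul]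
    rw [← ENNReal.ofReal_mul (Real.exp_pos _).le, ← Real.exp_add]
    simpa using this

theorem memLp_indicator_closedBall (hV : Continuous V) (R : ℝ) {F : Type*} [NormedAddCommGroup F]
    {f : EuclideanSpace ℝ (Fin d) → F} (hf : MemLp f 2 (expNeg V)) :
    MemLp ((Metric.closedBall 0 R).indicator f) 2 volume := by
  obtain ⟨c, hc, -, -, h⟩ := exists_expNeg_restrict_le hV R
  rw [memLp_indicator_iff_restrict measurableSet_closedBall]
  exact (hf.restrict _).of_measure_le_smul hc h

/-- Local approximation by smooth functions in `H¹(μ)`. -/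
theorem MemH1.exists_contDiff_closedBall (hV : Continuous V)
    {u : EuclideanSpace ℝ (Fin d) → ℝ} {G : EuclideanSpace ℝ (Fin d) → EuclideanSpace ℝ (Fin d)}
    (h : MemH1 (expNeg V) u G) (R : ℝ) {δ : ℝ≥0∞} (hδ : δ ≠ 0) :
    ∃ v : EuclideanSpace ℝ (Fin d) → ℝ, ContDiff ℝ ∞ v ∧
      eLpNorm (fun x => v x - u x) 2 ((expNeg V).restrict (Metric.closedBall 0 R)) ≤ δ ∧
      eLpNorm (fun x => ∇ v x - G x) 2 ((expNeg V).restrict (Metric.closedBall 0 R)) ≤ δ := by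
  obtain ⟨c, hc, hc0, hle, -⟩ := exists_expNeg_restrict_le hV R
  let φ : ℕ → ContDiffBump (0 : EuclideanSpace ℝ (Fin d)) := fun n =>
    ⟨1 / (2 * (n + 1)), 1 / (n + 1), by positivity, by
      apply one_div_lt_one_div_of_lt <;> nlinarith [(n.cast_nonneg : (0 : ℝ) ≤ n)]⟩
  have hφ : Tendsto (fun n => (φ n).rOut) atTop (𝓝 0) := tendsto_one_div_add_atTop_nhds_zero_nat
  have loc : ∀ {F : Type} [NormedAddCommGroup F] [NormedSpace ℝ F] [CompleteSpace F]
      {f : EuclideanSpace ℝ (Fin d) → F}, MemLp f 2 (expNeg V) →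
      Tendsto (fun n => eLpNorm (fun x => ((φ n).normed volume
        ⋆[ContinuousLinearMap.lsmul ℝ ℝ, volume] f) x - f x) 2
        ((expNeg V).restrict (Metric.closedBall 0 R))) atTop (𝓝 0) := by
    intro F _ _ _ f hf
    -- Truncation to radius R + 1 puts f in L²(dx); since the bumps have radius at most 1, it does
    -- not change the mollification on the ball of radius R.
    have ht := tendsto_eLpNorm_convolution_sub (memLp_indicator_closedBall hV (R + 1) hf) hφ
    have ht2 := ENNReal.Tendsto.const_mul (a := c ^ (1 / (2 : ℝ≥0∞)).toReal) ht
      (Or.inr (ENNReal.rpow_ne_top_of_nonneg (by positivity) hc))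
    rw [mul_zero] at ht2
    refine tendsto_of_tendsto_of_tendsto_of_le_of_le tendsto_const_nhds ht2 (fun _ => zero_le)
      fun n => ?_
    have hle1 : (φ n).rOut ≤ 1 := by
      change (1 : ℝ) / (n + 1) ≤ 1
      rw [div_le_one (by positivity)]
      linarith [(n.cast_nonneg : (0 : ℝ) ≤ n)]
    calc
      _ ≤ eLpNorm (fun x => ((φ n).normed volume
          ⋆[ContinuousLinearMap.lsmul ℝ ℝ, volume] f) x - f x) 2
          (c • volume.restrict (Metric.closedBall 0 R)) := eLpNorm_mono_measure _ hle
      _ = c ^ (1 / (2 : ℝ≥0∞)).toReal * eLpNorm (fun x => ((φ n).normed volume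
          ⋆[ContinuousLinearMap.lsmul ℝ ℝ, volume] f) x - f x) 2
          (volume.restrict (Metric.closedBall 0 R)) := by
            rw [eLpNorm_smul_measure_of_ne_zero hc0, smul_eq_mul]
      _ = c ^ (1 / (2 : ℝ≥0∞)).toReal * eLpNorm (fun x => ((φ n).normed volume
          ⋆[ContinuousLinearMap.lsmul ℝ ℝ, volume] ((Metric.closedBall 0 (R + 1)).indicator f)) x
            - (Metric.closedBall 0 (R + 1)).indicator f x) 2
          (volume.restrict (Metric.closedBall 0 R)) := by
            congr 1
            refine eLpNorm_congr_ae ?_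
            filter_upwards [ae_restrict_mem measurableSet_closedBall] with x hx
            rw [mem_closedBall_zero_iff] at hx
            congr 1
            · rw [convolution_def, convolution_def]
              refine integral_congr_ae (ae_of_all _ fun t => ?_)
              by_cases ht : (φ n).normed volume t = 0
              · simp [ht]
              · have ht' : t ∈ Function.support ((φ n).normed volume) := ht
                rw [ContDiffBump.support_normed_eq, mem_ball_zero_iff] at ht'
                have : x - t ∈ Metric.closedBall (0 : EuclideanSpace ℝ (Fin d)) (R + 1) := by
                  rw [mem_closedBall_zero_iff]
                  exact (norm_sub_le _ _).trans (by linarith)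
                simp [indicator_of_mem this]
            · rw [indicator_of_mem]
              rw [mem_closedBall_zero_iff]; linarith
      _ ≤ _ := by gcongr; exact Measure.restrict_le_self
  obtain ⟨n, hn1, hn2⟩ := (((ENNReal.tendsto_nhds_zero.1 (loc h.memLp)) δ
    (pos_iff_ne_zero.2 hδ)).and ((ENNReal.tendsto_nhds_zero.1 (loc h.memLp_grad)) δ
    (pos_iff_ne_zero.2 hδ))).exists
  refine ⟨_, h.isWeakGradient.contDiff_convolution (φ n).contDiff_normed
    (φ n).hasCompactSupport_normed, hn1, ?_⟩
  simp_rw [h.isWeakGradient.gradient_convolution (φ n).contDiff_normed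
    (φ n).hasCompactSupport_normed]
  exact hn2

end Density

/-! ### Density of test functions in H¹(μ) -/

section Density

variable {d : ℕ} {V : EuclideanSpace ℝ (Fin d) → ℝ}

theorem tendsto_eLpNorm_indicator_compl_closedBall {F : Type*} [NormedAddCommGroup F]
    {μ : Measure (EuclideanSpace ℝ (Fin d))} {f : EuclideanSpace ℝ (Fin d) → F}
    (hf : MemLp f 2 μ) :
    Tendsto (fun n : ℕ => eLpNorm ((Metric.closedBall 0 ((n : ℝ) + 1))ᶜ.indicator f) 2 μ) atTop
      (𝓝 0) := by
  have hsq : Tendsto (fun n : ℕ => eLpNorm ((Metric.closedBall 0 ((n : ℝ) + 1))ᶜ.indicator f) 2 μ ^ 2)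
      atTop (𝓝 0) := by
    simp_rw [eLpNorm_two_sq]
    have hfin : ∫⁻ x, ‖f x‖ₑ ^ 2 ∂μ ≠ ⊤ := by
      rw [← eLpNorm_two_sq]; exact ENNReal.pow_ne_top hf.eLpNorm_ne_top
    have := tendsto_lintegral_of_dominated_convergence' (μ := μ)
      (F := fun (n : ℕ) x => ‖(Metric.closedBall 0 ((n : ℝ) + 1))ᶜ.indicator f x‖ₑ ^ 2)
      (f := fun _ => 0) (fun x => ‖f x‖ₑ ^ 2)
      (fun n => (hf.1.indicator measurableSet_closedBall.compl).enorm.pow_const 2)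
      (fun n => ae_of_all _ fun x => by
        exact pow_le_pow_left' (enorm_indicator_le_enorm_self _ _) 2) hfin
      (ae_of_all _ fun x => by
        refine tendsto_const_nhds.congr' ?_
        filter_upwards [eventually_ge_atTop ⌈‖x‖⌉₊] with n hn
        have : x ∈ Metric.closedBall (0 : EuclideanSpace ℝ (Fin d)) ((n : ℝ) + 1) := by
          rw [mem_closedBall_zero_iff]
          have := Nat.ceil_le.1 hn
          linarith
        simp [this])
    simpa using this
  have := hsq.ennrpow_const (1 / 2)
  have e : ∀ a : ℝ≥0∞, (a ^ 2) ^ (1 / 2 : ℝ) = a := fun a => by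
    rw [← ENNReal.rpow_two, ← ENNReal.rpow_mul]; norm_num
  simpa only [e, ENNReal.zero_rpow_of_pos (show (0 : ℝ) < 1 / 2 by norm_num)] using this

theorem gradient_mul {E : Type*} [NormedAddCommGroup E] [InnerProductSpace ℝ E] [CompleteSpace E]
    {f g : E → ℝ} {x : E} (hf : DifferentiableAt ℝ f x) (hg : DifferentiableAt ℝ g x) :
    ∇ (fun y => f y * g y) x = f x • ∇ g x + g x • ∇ f x := by
  simp [gradient, fderiv_fun_mul hf hg]

theorem gradient_sq {E : Type*} [NormedAddCommGroup E] [InnerProductSpace ℝ E] [CompleteSpace E]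
    {u : E → ℝ} {x : E} (hu : DifferentiableAt ℝ u x) :
    ∇ (fun y => u y ^ 2) x = (2 * u x) • ∇ u x := by
  have : (fun y => u y ^ 2) = fun y => u y * u y := by ext; ring
  rw [this, gradient_mul hu hu]
  module

theorem continuous_gradient {E : Type*} [NormedAddCommGroup E] [InnerProductSpace ℝ E]
    [CompleteSpace E] {f : E → ℝ} (hf : ContDiff ℝ 1 f) : Continuous (∇ f) :=
  (toDual ℝ E).symm.continuous.comp (hf.continuous_fderiv one_ne_zero)

theorem norm_gradient {E : Type*} [NormedAddCommGroup E] [InnerProductSpace ℝ E]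
    [CompleteSpace E] (f : E → ℝ) (x : E) : ‖∇ f x‖ = ‖fderiv ℝ f x‖ :=
  (toDual ℝ E).symm.norm_map _

/-- Cutoffs equal to `1` on the ball of radius `r`, supported in the ball of radius `2 r`, with
gradient of size `1 / r`. -/
theorem exists_cutoff (d : ℕ) : ∃ K : ℝ, 0 ≤ K ∧ ∀ r : ℝ, 0 < r →
    ∃ χ : EuclideanSpace ℝ (Fin d) → ℝ, ContDiff ℝ ∞ χ ∧ HasCompactSupport χ ∧
      (∀ x, ‖x‖ ≤ r → χ x = 1) ∧ (∀ x, 2 * r < ‖x‖ → χ x = 0 ) ∧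
      (∀ x, 2 * r < ‖x‖ → ∇ χ x = 0) ∧ (∀ x, 0 ≤ χ x) ∧ (∀ x, χ x ≤ 1) ∧
      ∀ x, ‖∇ χ x‖ ≤ K / r := by
  let f : ContDiffBump (0 : EuclideanSpace ℝ (Fin d)) := ⟨1, 2, one_pos, one_lt_two⟩
  have hf : ContDiff ℝ ∞ f := f.contDiff
  obtain ⟨K, hK⟩ := (f.hasCompactSupport.fderiv ℝ).exists_bound_of_continuous
    (hf.continuous_fderiv (by simp))
  refine ⟨K, (norm_nonneg _).trans (hK 0), fun r hr => ?_⟩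
  have hs : ContDiff ℝ ∞ fun x => f (r⁻¹ • x) := hf.comp (contDiff_const_smul _)
  have h0 : ∀ x : EuclideanSpace ℝ (Fin d), 2 * r < ‖x‖ → f (r⁻¹ • x) = 0 := fun x hx =>
    f.zero_of_le_dist (by
      rw [dist_zero_right, norm_smul, norm_inv, Real.norm_of_nonneg hr.le, inv_mul_eq_div,
        le_div_iff₀ hr]
      exact hx.le)
  refine ⟨fun x => f (r⁻¹ • x), hs,
    f.hasCompactSupport.comp_homeomorph (Homeomorph.smulOfNeZero r⁻¹ (inv_ne_zero hr.ne')),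
    fun x hx => f.one_of_mem_closedBall ?_, h0, fun x hx => ?_, fun x => f.nonneg, fun x => f.le_one,
    fun x => ?_⟩
  · rw [mem_closedBall_zero_iff, norm_smul, norm_inv, Real.norm_of_nonneg hr.le, inv_mul_eq_div,
        div_le_one hr]
    exact hx
  · have : (fun x => f (r⁻¹ • x)) =ᶠ[𝓝 x] fun _ => 0 := by
      filter_upwards [(isOpen_lt continuous_const continuous_norm).mem_nhds hx] with y hy
      exact h0 y hy
    rw [this.gradient_eq, gradient_fun_const]
  · rw [norm_gradient, fderiv_comp_smul, norm_smul, norm_inv, Real.norm_of_nonneg hr.le,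
      inv_mul_eq_div]
    gcongr
    exact hK _

/-- Smooth compactly supported functions are dense in `H¹(e^{-V} dx)`. -/
theorem MemH1.exists_seq_tendsto (hV : Continuous V)
    {u : EuclideanSpace ℝ (Fin d) → ℝ} {G : EuclideanSpace ℝ (Fin d) → EuclideanSpace ℝ (Fin d)}
    (h : MemH1 (expNeg V) u G) :
    ∃ w : ℕ → EuclideanSpace ℝ (Fin d) → ℝ, (∀ n, ContDiff ℝ ∞ (w n)) ∧
      (∀ n, HasCompactSupport (w n)) ∧
      Tendsto (fun n => eLpNorm (fun x => w n x - u x) 2 (expNeg V)) atTop (𝓝 0) ∧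
      Tendsto (fun n => eLpNorm (fun x => ∇ (w n) x - G x) 2 (expNeg V)) atTop (𝓝 0) := by
  obtain ⟨K, hK0, hK⟩ := exists_cutoff d
  have hpos : ∀ n : ℕ, (0 : ℝ) < n + 1 := fun n => by positivity
  choose χ hχ1 hχ2 hχ3 hχ4 hχ5 hχ6 hχ7 hχ8 using fun n : ℕ => hK (n + 1) (hpos n)
  -- The radius 2(n+1) is where the n-th cutoff ends, so v n is controlled wherever χ n is nonzero.
  choose v hv1 hv2 hv3 using fun n : ℕ => h.exists_contDiff_closedBall hV (2 * (n + 1))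
    (δ := ENNReal.ofReal (1 / (n + 1))) (by simpa using hpos n)
  let B : ℕ → Set (EuclideanSpace ℝ (Fin d)) := fun n => Metric.closedBall 0 (2 * (n + 1))
  let A : ℕ → Set (EuclideanSpace ℝ (Fin d)) := fun n => (Metric.closedBall 0 ((n : ℝ) + 1))ᶜ
  have hB : ∀ n, MeasurableSet (B n) := fun n => measurableSet_closedBall
  have hA : ∀ n, MeasurableSet (A n) := fun n => measurableSet_closedBall.compl
  have hδ : Tendsto (fun n : ℕ => ENNReal.ofReal (1 / (n + 1))) atTop (𝓝 0) := by
    have := ENNReal.tendsto_ofReal tendsto_one_div_add_atTop_nhds_zero_nat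
    simpa using this
  have hv1' : ∀ n, ContDiff ℝ 1 (v n) := fun n => (hv1 n).of_le (by simp)
  have hχ1' : ∀ n, ContDiff ℝ 1 (χ n) := fun n => (hχ1 n).of_le (by simp)
  have mvu : ∀ n, AEStronglyMeasurable (fun x => v n x - u x) (expNeg V) := fun n =>
    (hv1 n).continuous.aestronglyMeasurable.sub h.memLp.1
  have mvG : ∀ n, AEStronglyMeasurable (fun x => ∇ (v n) x - G x) (expNeg V) := fun n =>
    (continuous_gradient (hv1' n)).aestronglyMeasurable.sub h.memLp_grad.1
  have hχabs : ∀ n x, |χ n x| ≤ 1 := fun n x => by rw [abs_of_nonneg (hχ6 n x)]; exact hχ7 n x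
  have hχabs' : ∀ n x, |χ n x - 1| ≤ 1 := fun n x => by
    rw [abs_le]; constructor <;> linarith [hχ6 n x, hχ7 n x]
  refine ⟨fun n x => χ n x * v n x, fun n => (hχ1 n).mul (hv1 n), fun n => (hχ2 n).mul_right,
    ?_, ?_⟩
  · have hlim := hδ.add (tendsto_eLpNorm_indicator_compl_closedBall h.memLp)
    rw [add_zero] at hlim
    refine tendsto_of_tendsto_of_tendsto_of_le_of_le tendsto_const_nhds hlim (fun _ => zero_le)
      fun n => ?_
    calc
      _ ≤ eLpNorm (fun x => ‖(B n).indicator (fun x => v n x - u x) x‖ +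
            ‖(A n).indicator u x‖) 2 (expNeg V) := by
          refine eLpNorm_mono_real fun x => ?_
          by_cases hx : x ∈ A n
          · by_cases hx' : x ∈ B n
            · simp only [indicator_of_mem hx, indicator_of_mem hx', Real.norm_eq_abs]
              calc |χ n x * v n x - u x| = |χ n x * (v n x - u x) + (χ n x - 1) * u x| := by
                    congr 1; ring
                _ ≤ |χ n x| * |v n x - u x| + |χ n x - 1| * |u x| := by
                    rw [← abs_mul, ← abs_mul]; exact abs_add_le _ _
                _ ≤ 1 * |v n x - u x| + 1 * |u x| := by
                    gcongr
                    exacts [hχabs n x, hχabs' n x]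
                _ = _ := by ring
            · have : χ n x = 0 := hχ4 n x (by simpa [B] using hx')
              simp [this, indicator_of_mem hx, indicator_of_notMem hx']
          · have hxn : ‖x‖ ≤ n + 1 := by simpa [A] using hx
            have hx' : x ∈ B n := by
              simp only [B, mem_closedBall_zero_iff]; linarith [hpos n]
            simp [hχ3 n x hxn, indicator_of_mem hx', indicator_of_notMem hx]
      _ ≤ eLpNorm (fun x => ‖(B n).indicator (fun x => v n x - u x) x‖) 2 (expNeg V) +
            eLpNorm (fun x => ‖(A n).indicator u x‖) 2 (expNeg V) :=
          eLpNorm_add_le ((mvu n).indicator (hB n)).norm (h.memLp.1.indicator (hA n)).norm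
            (by norm_num)
      _ ≤ _ := by
          rw [eLpNorm_norm, eLpNorm_norm, eLpNorm_indicator_eq_eLpNorm_restrict (hB n)]
          gcongr
          exact hv2 n
  -- The extra term v∇χ of the product rule is at most K/(n+1) times |v|, and v stays bounded in L²
  -- on the support of the cutoff.
  · have hlim : Tendsto (fun n : ℕ => ENNReal.ofReal (1 / (n + 1)) +
        eLpNorm ((Metric.closedBall 0 ((n : ℝ) + 1))ᶜ.indicator G) 2 (expNeg V) +
        ENNReal.ofReal K * ENNReal.ofReal (1 / (n + 1)) *
          (ENNReal.ofReal (1 / (n + 1)) + eLpNorm u 2 (expNeg V))) atTop (𝓝 (0 + 0 +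
          ENNReal.ofReal K * 0 * (0 + eLpNorm u 2 (expNeg V)))) := by
      refine (hδ.add (tendsto_eLpNorm_indicator_compl_closedBall h.memLp_grad)).add
        (ENNReal.Tendsto.mul (ENNReal.Tendsto.const_mul hδ (Or.inr ENNReal.ofReal_ne_top)) ?_
          (hδ.add tendsto_const_nhds) ?_)
      · right; simpa using h.memLp.eLpNorm_ne_top
      · right; simp
    simp only [mul_zero, zero_mul, add_zero] at hlim
    refine tendsto_of_tendsto_of_tendsto_of_le_of_le tendsto_const_nhds hlim (fun _ => zero_le)
      fun n => ?_
    have hKn : 0 ≤ K / (n + 1) := div_nonneg hK0 (hpos n).le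
    calc
      _ ≤ eLpNorm (fun x => ‖(B n).indicator (fun x => ∇ (v n) x - G x) x‖ +
            ‖(A n).indicator G x‖ + K / (n + 1) * (‖(B n).indicator (fun x => v n x - u x) x‖ +
              ‖u x‖)) 2 (expNeg V) := by
          refine eLpNorm_mono_real fun x => ?_
          rw [gradient_mul ((hχ1' n).differentiable one_ne_zero x)
            ((hv1' n).differentiable one_ne_zero x)]
          by_cases hx' : x ∈ B n
          · have h1 : ‖χ n x • ∇ (v n) x - G x‖ ≤ ‖(B n).indicator (fun x => ∇ (v n) x - G x) x‖ +
                ‖(A n).indicator G x‖ := by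
              by_cases hx : x ∈ A n
              · simp only [indicator_of_mem hx, indicator_of_mem hx']
                calc ‖χ n x • ∇ (v n) x - G x‖
                    = ‖χ n x • (∇ (v n) x - G x) + (χ n x - 1) • G x‖ := by
                      congr 1; module
                  _ ≤ |χ n x| * ‖∇ (v n) x - G x‖ + |χ n x - 1| * ‖G x‖ := by
                      rw [← Real.norm_eq_abs, ← Real.norm_eq_abs, ← norm_smul, ← norm_smul]
                      exact norm_add_le _ _
                  _ ≤ 1 * ‖∇ (v n) x - G x‖ + 1 * ‖G x‖ := by
                      gcongr
                      exacts [hχabs n x, hχabs' n x]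
                  _ = _ := by ring
              · have hxn : ‖x‖ ≤ n + 1 := by simpa [A] using hx
                simp [hχ3 n x hxn, indicator_of_mem hx', indicator_of_notMem hx]
            have h2 : ‖v n x • ∇ (χ n) x‖ ≤ K / (n + 1) *
                (‖(B n).indicator (fun x => v n x - u x) x‖ + ‖u x‖) := by
              rw [indicator_of_mem hx', norm_smul, mul_comm]
              gcongr
              · exact hχ8 n x
              · simpa using norm_add_le (v n x - u x) (u x)
            calc _ = ‖(χ n x • ∇ (v n) x - G x) + v n x • ∇ (χ n) x‖ := by congr 1; abel
              _ ≤ _ := (norm_add_le _ _).trans (add_le_add h1 h2)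
          · have hx2 : 2 * ((n : ℝ) + 1) < ‖x‖ := by simpa [B] using hx'
            have hx : x ∈ A n := by
              simp only [A, mem_compl_iff, mem_closedBall_zero_iff, not_le]; linarith [hpos n]
            rw [hχ4 n x hx2, hχ5 n x hx2]
            simp only [indicator_of_mem hx, indicator_of_notMem hx', zero_smul, smul_zero,
              add_zero, zero_sub, norm_neg, norm_zero, zero_add]
            exact le_add_of_nonneg_right (mul_nonneg hKn (norm_nonneg _))
      _ ≤ eLpNorm (fun x => ‖(B n).indicator (fun x => ∇ (v n) x - G x) x‖) 2 (expNeg V) +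
            eLpNorm (fun x => ‖(A n).indicator G x‖) 2 (expNeg V) +
            ‖K / ((n : ℝ) + 1)‖ₑ *
              (eLpNorm (fun x => ‖(B n).indicator (fun x => v n x - u x) x‖) 2 (expNeg V) +
              eLpNorm (fun x => ‖u x‖) 2 (expNeg V)) := by
          have m1 := ((mvG n).indicator (hB n)).norm
          have m2 := (h.memLp_grad.1.indicator (hA n)).norm
          have m3 := ((mvu n).indicator (hB n)).norm
          have m4 := h.memLp.1.norm
          refine (eLpNorm_add_le (m1.add m2) ((m3.add m4).const_mul _) (by norm_num)).trans ?_
          gcongr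
          · exact eLpNorm_add_le m1 m2 (by norm_num)
          · refine (eLpNorm_const_smul_le (c := K / ((n : ℝ) + 1))).trans ?_
            gcongr
            exact eLpNorm_add_le m3 m4 (by norm_num)
      _ ≤ _ := by
          simp only [eLpNorm_norm]
          rw [eLpNorm_indicator_eq_eLpNorm_restrict (hB n),
            eLpNorm_indicator_eq_eLpNorm_restrict (hB n), Real.enorm_of_nonneg hKn,
            ← ENNReal.ofReal_mul hK0, mul_one_div]
          gcongr
          exacts [hv3 n, hv2 n]

end Density

/-! ### Passing to the limit in square integrals -/

section SquareIntegrals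

variable {α F : Type*} [MeasurableSpace α] [NormedAddCommGroup F] {μ : Measure α}

theorem integral_norm_sq_eq_toReal_eLpNorm {f : α → F} (hf : MemLp f 2 μ) :
    ∫ x, ‖f x‖ ^ 2 ∂μ = (eLpNorm f 2 μ).toReal ^ 2 := by
  rw [← ENNReal.toReal_pow, eLpNorm_two_sq, integral_eq_lintegral_of_nonneg_ae
    (f := fun x => ‖f x‖ ^ 2)
    (ae_of_all _ fun x => by positivity) (hf.1.norm.pow 2)]
  congr 1
  refine lintegral_congr fun x => ?_
  rw [ENNReal.ofReal_pow (norm_nonneg _), ofReal_norm]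

theorem tendsto_integral_norm_sq {f : ℕ → α → F} {g : α → F} (hf : ∀ n, MemLp (f n) 2 μ)
    (hg : MemLp g 2 μ) (h : Tendsto (fun n => eLpNorm (fun x => f n x - g x) 2 μ) atTop (𝓝 0)) :
    Tendsto (fun n => ∫ x, ‖f n x‖ ^ 2 ∂μ) atTop (𝓝 (∫ x, ‖g x‖ ^ 2 ∂μ)) := by
  have h1 : Tendsto (fun n => (hf n).toLp (f n)) atTop (𝓝 (hg.toLp g)) := by
    rw [Lp.tendsto_Lp_iff_tendsto_eLpNorm'']
    exact h
  simp_rw [fun n => integral_norm_sq_eq_toReal_eLpNorm (hf n), integral_norm_sq_eq_toReal_eLpNorm hg]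
  have := (h1.norm).pow 2
  simpa only [Lp.norm_toLp] using this

theorem tendsto_integral_of_tendsto_eLpNorm_two [NormedSpace ℝ F] [IsFiniteMeasure μ]
    {f : ℕ → α → F} {g : α → F} (hf : ∀ n, MemLp (f n) 2 μ)
    (hg : MemLp g 2 μ) (h : Tendsto (fun n => eLpNorm (fun x => f n x - g x) 2 μ) atTop (𝓝 0)) :
    Tendsto (fun n => ∫ x, f n x ∂μ) atTop (𝓝 (∫ x, g x ∂μ)) := by
  refine tendsto_integral_of_L1' g hg.1
    (Eventually.of_forall fun n => (hf n).integrable one_le_two) ?_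
  have h2 : Tendsto (fun n => eLpNorm (fun x => f n x - g x) 2 μ *
      μ univ ^ (1 / (1 : ℝ≥0∞).toReal - 1 / (2 : ℝ≥0∞).toReal)) atTop (𝓝 (0 * _)) :=
    ENNReal.Tendsto.mul_const h (Or.inr (ENNReal.rpow_ne_top_of_nonneg (by norm_num)
      (measure_ne_top μ _)))
  rw [zero_mul] at h2
  exact tendsto_of_tendsto_of_tendsto_of_le_of_le tendsto_const_nhds h2 (fun _ => zero_le)
    fun n => eLpNorm_le_eLpNorm_mul_rpow_measure_univ one_le_two ((hf n).1.sub hg.1)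

end SquareIntegrals

/-! ### The ground state transform -/

section GroundState

variable {E : Type*} [NormedAddCommGroup E] [InnerProductSpace ℝ E] [FiniteDimensional ℝ E]
  [MeasurableSpace E] [BorelSpace E]

/-- In this form Green's identity reduces to integration by parts in one direction at a time. -/
theorem laplacian_eq_sum_fderiv {V : E → ℝ} (hV : ContDiff ℝ 2 V) (x : E) :
    (Δ V) x = ∑ i, fderiv ℝ (fun y => fderiv ℝ V y (stdOrthonormalBasis ℝ E i)) x
      (stdOrthonormalBasis ℝ E i) := by
  rw [laplacian_eq_iteratedFDeriv_stdOrthonormalBasis]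
  refine Finset.sum_congr rfl fun i _ => ?_
  have hd : DifferentiableAt ℝ (fderiv ℝ V) x :=
    (hV.fderiv_right (m := 1) (by norm_num)).differentiable one_ne_zero x
  rw [iteratedFDeriv_two_apply, fderiv_clm_apply hd (differentiableAt_const _)]
  simp

theorem continuous_laplacian {V : E → ℝ} (hV : ContDiff ℝ 2 V) : Continuous (Δ V) := by
  have : (Δ V) = fun x => ∑ i, fderiv ℝ (fun y => fderiv ℝ V y (stdOrthonormalBasis ℝ E i)) x
      (stdOrthonormalBasis ℝ E i) := funext (laplacian_eq_sum_fderiv hV)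
  rw [this]
  refine continuous_finsetSum _ fun i _ => ?_
  have : ContDiff ℝ 1 (fun y => fderiv ℝ V y (stdOrthonormalBasis ℝ E i)) :=
    (hV.fderiv_right (m := 1) (by norm_num)).clm_apply contDiff_const
  exact (this.continuous_fderiv one_ne_zero).clm_apply continuous_const

/-- Green's identity against a compactly supported function. -/
theorem integral_mul_laplacian {V g : E → ℝ} (hV : ContDiff ℝ 2 V) (hg : ContDiff ℝ 1 g)
    (hgs : HasCompactSupport g) :
    ∫ x, g x * (Δ V) x = - ∫ x, inner ℝ (∇ g x) (∇ V x) := by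
  set b := stdOrthonormalBasis ℝ E
  have hVi : ∀ i, ContDiff ℝ 1 (fun y => fderiv ℝ V y (b i)) := fun i =>
    (hV.fderiv_right (m := 1) (by norm_num)).clm_apply contDiff_const
  have hgd : ∀ i, Continuous fun x => fderiv ℝ g x (b i) := fun i =>
    (hg.continuous_fderiv one_ne_zero).clm_apply continuous_const
  have hgds : ∀ i, HasCompactSupport fun x => fderiv ℝ g x (b i) := fun i =>
    hgs.fderiv_apply ℝ (b i)
  have hVid : ∀ i, Continuous fun x => fderiv ℝ (fun y => fderiv ℝ V y (b i)) x (b i) := fun i =>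
    ((hVi i).continuous_fderiv one_ne_zero).clm_apply continuous_const
  have i1 : ∀ i, Integrable fun x => g x * fderiv ℝ (fun y => fderiv ℝ V y (b i)) x (b i) :=
    fun i => (hg.continuous.mul (hVid i)).integrable_of_hasCompactSupport hgs.mul_right
  have i2 : ∀ i, Integrable fun x => fderiv ℝ g x (b i) * fderiv ℝ V x (b i) :=
    fun i => ((hgd i).mul (hVi i).continuous).integrable_of_hasCompactSupport (hgds i).mul_right
  have i3 : ∀ i, Integrable fun x => g x * fderiv ℝ V x (b i) :=
    fun i => (hg.continuous.mul (hVi i).continuous).integrable_of_hasCompactSupport hgs.mul_right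
  have key : ∀ i, ∫ x, g x * fderiv ℝ (fun y => fderiv ℝ V y (b i)) x (b i) =
      - ∫ x, fderiv ℝ g x (b i) * fderiv ℝ V x (b i) := fun i =>
    integral_mul_fderiv_eq_neg_fderiv_mul_of_integrable (i2 i) (i1 i) (i3 i)
      (fun x _ => hg.differentiable one_ne_zero x) (fun x _ => (hVi i).differentiable one_ne_zero x)
  simp_rw [laplacian_eq_sum_fderiv hV, Finset.mul_sum]
  rw [integral_finsetSum _ fun i _ => i1 i, Finset.sum_congr rfl fun i _ => key i,
    Finset.sum_neg_distrib, ← integral_finsetSum _ fun i _ => i2 i]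
  congr 1
  refine integral_congr_ae (ae_of_all _ fun x => ?_)
  simp only
  rw [← b.sum_inner_mul_inner]
  refine Finset.sum_congr rfl fun i _ => ?_
  rw [inner_gradient_left, real_inner_comm, inner_gradient_left]

/-- The divisor lets one formula cover both weights: c = 2 for the transform, c = 1 for e^{-V}
itself. -/
theorem gradient_exp_neg_div {V : E → ℝ} {x : E} (hV : DifferentiableAt ℝ V x) (c : ℝ) :
    ∇ (fun y => Real.exp (-V y / c)) x = (-(Real.exp (-V x / c) / c)) • ∇ V x := by
  have h : HasFDerivAt (fun y => Real.exp (-V y / c)) _ x :=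
    ((hV.hasFDerivAt.neg).mul_const c⁻¹).exp
  simp only [gradient]
  rw [h.fderiv]
  simp only [map_smul, map_neg, smul_neg, neg_smul, smul_smul]
  simp [div_eq_mul_inv]

theorem hasCompactSupport_gradient {u : E → ℝ} (hu : HasCompactSupport u) :
    HasCompactSupport (∇ u) :=
  (hu.fderiv ℝ).comp_left (g := (toDual ℝ E).symm) (map_zero _)

/-- The ground state transform turns the Dirichlet form of `e^{-V} dx` into a Schrödinger form. -/
theorem integral_norm_gradient_mul_exp_sq {V u : E → ℝ} (hV : ContDiff ℝ 2 V)
    (hu : ContDiff ℝ 1 u) (hus : HasCompactSupport u) :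
    ∫ x, ‖∇ (fun y => u y * Real.exp (-V y / 2)) x‖ ^ 2 =
      (∫ x, Real.exp (-V x) * ‖∇ u x‖ ^ 2) -
        ∫ x, Real.exp (-V x) * (u x ^ 2 * ((‖∇ V x‖ ^ 2 - 2 * (Δ V) x) / 4)) := by
  have hV1 : ContDiff ℝ 1 V := hV.of_le (by norm_num)
  have hVd := hV1.differentiable one_ne_zero
  have hud := hu.differentiable one_ne_zero
  have hexp : ∀ (c : ℝ) x, ∇ (fun y => Real.exp (-V y / c)) x =
      (-(Real.exp (-V x / c) / c)) • ∇ V x := fun c x => gradient_exp_neg_div (hVd x) c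
  have hexpc : ∀ c : ℝ, ContDiff ℝ 1 fun y => Real.exp (-V y / c) := fun c =>
    ((hV1.neg).div_const c).exp
  have hg : ContDiff ℝ 1 fun x => u x ^ 2 * Real.exp (-V x / 1) := (hu.pow 2).mul (hexpc 1)
  have hgs : HasCompactSupport fun x => u x ^ 2 * Real.exp (-V x / 1) := by
    have : HasCompactSupport fun x => u x ^ 2 := hus.comp_left (g := fun t => t ^ 2) (by simp)
    exact this.mul_right
  -- Testing ΔV against u² e^{-V} trades the cross term u⟨∇u, ∇V⟩ of |∇w|² for u²|∇V|² and u²ΔV.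
  have green := integral_mul_laplacian hV hg hgs
  have gg : ∀ x, inner ℝ (∇ (fun y => u y ^ 2 * Real.exp (-V y / 1)) x) (∇ V x) =
      Real.exp (-V x) * (2 * u x * inner ℝ (∇ u x) (∇ V x)) -
        Real.exp (-V x) * (u x ^ 2 * ‖∇ V x‖ ^ 2) := fun x => by
    rw [gradient_mul (f := fun y => u y ^ 2) ((hud x).pow 2) ((hexpc 1).differentiable one_ne_zero x), hexp, gradient_sq (hud x)]
    simp only [inner_add_left, inner_smul_left, div_one, conj_trivial, real_inner_self_eq_norm_sq]
    ring
  have gw : ∀ x, ‖∇ (fun y => u y * Real.exp (-V y / 2)) x‖ ^ 2 =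
      Real.exp (-V x) * ‖∇ u x‖ ^ 2 - Real.exp (-V x) * (u x * inner ℝ (∇ u x) (∇ V x)) +
        Real.exp (-V x) * (u x ^ 2 * (‖∇ V x‖ ^ 2 / 4)) := fun x => by
    have he : Real.exp (-V x) = Real.exp (-V x / 2) ^ 2 := by
      rw [← Real.exp_nat_mul]; congr 1; push_cast; ring
    rw [gradient_mul (hud x) ((hexpc 2).differentiable one_ne_zero x), hexp, norm_add_sq_real, he]
    simp only [norm_smul, inner_smul_left, inner_smul_right, conj_trivial, Real.norm_eq_abs,
      mul_pow, sq_abs]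
    rw [real_inner_comm]
    ring
  have hE : Continuous fun x => Real.exp (-V x) := Real.continuous_exp.comp hV1.continuous.neg
  have cu := continuous_gradient hu
  have cV := continuous_gradient hV1
  have cL := continuous_laplacian hV
  have hus2 : HasCompactSupport fun x => u x ^ 2 := hus.comp_left (g := fun t => t ^ 2) (by simp)
  have hcs : ∀ {f : E → ℝ}, HasCompactSupport f → HasCompactSupport fun x => Real.exp (-V x) * f x :=
    fun h => h.mul_left
  have hgus2 : HasCompactSupport fun x => ‖∇ u x‖ ^ 2 :=
    (hasCompactSupport_gradient hus).comp_left (g := fun t : E => ‖t‖ ^ 2) (by simp)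
  have i1 : Integrable fun x => Real.exp (-V x) * ‖∇ u x‖ ^ 2 :=
    ((hE.mul (cu.norm.pow 2)) : Continuous fun x => Real.exp (-V x) * ‖∇ u x‖ ^ 2).integrable_of_hasCompactSupport
      (hcs hgus2)
  have i2 : Integrable fun x => Real.exp (-V x) * (u x * inner ℝ (∇ u x) (∇ V x)) :=
    (hE.mul (hu.continuous.mul (cu.inner cV))).integrable_of_hasCompactSupport (hcs hus.mul_right)
  have i3 : Integrable fun x => Real.exp (-V x) * (u x ^ 2 * ‖∇ V x‖ ^ 2) :=
    (hE.mul ((hu.continuous.pow 2).mul (cV.norm.pow 2))).integrable_of_hasCompactSupport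
      (hcs hus2.mul_right)
  have i4 : Integrable fun x => u x ^ 2 * Real.exp (-V x / 1) * (Δ V) x :=
    (hg.continuous.mul cL).integrable_of_hasCompactSupport hgs.mul_right
  have e1 : ∫ x, ‖∇ (fun y => u y * Real.exp (-V y / 2)) x‖ ^ 2 =
      (∫ x, Real.exp (-V x) * ‖∇ u x‖ ^ 2) -
        (∫ x, Real.exp (-V x) * (u x * inner ℝ (∇ u x) (∇ V x))) +
        (∫ x, Real.exp (-V x) * (u x ^ 2 * ‖∇ V x‖ ^ 2)) * (1 / 4) := by
    have i12 : Integrable fun x => Real.exp (-V x) * ‖∇ u x‖ ^ 2 -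
        Real.exp (-V x) * (u x * inner ℝ (∇ u x) (∇ V x)) := i1.sub i2
    rw [← integral_sub i1 i2, ← integral_mul_const, ← integral_add i12 (i3.mul_const _)]
    refine integral_congr_ae (ae_of_all _ fun x => ?_)
    simp only [gw]
    ring
  have e2 : ∫ x, u x ^ 2 * Real.exp (-V x / 1) * (Δ V) x =
      (∫ x, Real.exp (-V x) * (u x ^ 2 * ‖∇ V x‖ ^ 2)) -
        2 * ∫ x, Real.exp (-V x) * (u x * inner ℝ (∇ u x) (∇ V x)) := by
    rw [green, ← integral_const_mul, ← integral_sub i3 (i2.const_mul 2), ← integral_neg]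
    refine integral_congr_ae (ae_of_all _ fun x => ?_)
    simp only [gg]
    ring
  have e3 : ∫ x, Real.exp (-V x) * (u x ^ 2 * ((‖∇ V x‖ ^ 2 - 2 * (Δ V) x) / 4)) =
      (∫ x, Real.exp (-V x) * (u x ^ 2 * ‖∇ V x‖ ^ 2)) * (1 / 4) -
        (∫ x, u x ^ 2 * Real.exp (-V x / 1) * (Δ V) x) * (1 / 2) := by
    rw [← integral_mul_const, ← integral_mul_const,
      ← integral_sub (i3.mul_const _) (i4.mul_const _)]
    refine integral_congr_ae (ae_of_all _ fun x => ?_)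
    simp only [div_one]
    ring
  rw [e1, e3, e2]
  ring

end GroundState

/-! ### Poincaré's inequality on Euclidean balls -/

section LocalPoincare

variable {E : Type*} [NormedAddCommGroup E] [InnerProductSpace ℝ E] [FiniteDimensional ℝ E]
  [MeasurableSpace E] [BorelSpace E]

/-- The fundamental theorem of calculus along the segment, then Cauchy–Schwarz on the unit interval.
-/
theorem enorm_sub_sq_le_lintegral_segment {u : E → ℝ} (hu : ContDiff ℝ 1 u) (x y : E) :
    ‖u y - u x‖ₑ ^ 2 ≤ ‖y - x‖ₑ ^ 2 * ∫⁻ t in Ioc (0 : ℝ) 1, ‖∇ u (x + t • (y - x))‖ₑ ^ 2 := by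
  have hprob : IsProbabilityMeasure (volume.restrict (Ioc (0 : ℝ) 1)) :=
    ⟨by simp [Measure.restrict_apply]⟩
  have hcl : Continuous fun t : ℝ => x + t • (y - x) := by fun_prop
  have hcg : Continuous fun t : ℝ => ∇ u (x + t • (y - x)) := (continuous_gradient hu).comp hcl
  have hder : ∀ t : ℝ, HasDerivAt (fun t : ℝ => u (x + t • (y - x)))
      (inner ℝ (∇ u (x + t • (y - x))) (y - x)) t := fun t => by
    have h1 : HasDerivAt (fun t : ℝ => x + t • (y - x)) (y - x) t := by
      simpa using ((hasDerivAt_id t).smul_const (y - x)).const_add x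
    have h2 := ((hu.differentiable one_ne_zero) (x + t • (y - x))).hasFDerivAt.comp_hasDerivAt t h1
    rw [inner_gradient_left]
    exact h2
  have hc : Continuous fun t : ℝ => inner ℝ (∇ u (x + t • (y - x))) (y - x) :=
    hcg.inner continuous_const
  have ftc : u y - u x = ∫ t in Ioc (0 : ℝ) 1, inner ℝ (∇ u (x + t • (y - x))) (y - x) := by
    rw [← intervalIntegral.integral_of_le zero_le_one,
      intervalIntegral.integral_eq_sub_of_hasDerivAt (fun t _ => hder t)
        (hc.intervalIntegrable _ _)]
    simp
  have e1 : ‖u y - u x‖ₑ ≤ ‖y - x‖ₑ * ∫⁻ t in Ioc (0 : ℝ) 1, ‖∇ u (x + t • (y - x))‖ₑ := by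
    rw [ftc, ← lintegral_const_mul' _ _ enorm_ne_top]
    refine (enorm_integral_le_lintegral_enorm _).trans (lintegral_mono fun t => ?_)
    rw [← ofReal_norm, ← ofReal_norm, ← ofReal_norm, ← ENNReal.ofReal_mul (norm_nonneg _)]
    apply ENNReal.ofReal_le_ofReal
    rw [mul_comm]
    exact norm_inner_le_norm _ _
  have e2 := eLpNorm_le_eLpNorm_of_exponent_le (p := 1) (q := 2) (by norm_num)
    (hcg.aestronglyMeasurable (μ := volume.restrict (Ioc (0 : ℝ) 1)))
  rw [eLpNorm_one_eq_lintegral_enorm] at e2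
  calc _ ≤ (‖y - x‖ₑ * eLpNorm (fun t : ℝ => ∇ u (x + t • (y - x))) 2
        (volume.restrict (Ioc (0 : ℝ) 1))) ^ 2 := by
        refine pow_le_pow_left' (e1.trans ?_) 2
        gcongr
    _ = _ := by rw [mul_pow, eLpNorm_two_sq]

theorem lintegral_comp_add_smul {g : E → ℝ≥0∞} (hg : Measurable g) (a : E) {t : ℝ} (ht : t ≠ 0) :
    ∫⁻ y, g (a + t • y) = ENNReal.ofReal |(t ^ Module.finrank ℝ E)⁻¹| * ∫⁻ y, g y := by
  have h := lintegral_map (μ := (volume : Measure E)) (f := fun z => g (a + z)) (g := (t • ·))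
    (hg.comp (measurable_const_add a)) (measurable_const_smul t)
  rw [← h, Measure.map_addHaar_smul _ ht, lintegral_smul_measure, lintegral_add_left_eq_self,
    smul_eq_mul]

/-- For fixed x the map y ↦ x + t(y - x) sends B into itself with Jacobian t^n; its inverse is at
most 2^n only when t stays away from 0. -/
theorem lintegral_lintegral_segment_le_of_half_le {B : Set E} (hB : MeasurableSet B)
    (hBc : Convex ℝ B) {g : E → ℝ≥0∞} (hg : Measurable g) {t : ℝ} (ht : 1 / 2 ≤ t) (ht1 : t ≤ 1) :
    ∫⁻ x in B, ∫⁻ y in B, g (x + t • (y - x)) ≤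
      2 ^ Module.finrank ℝ E * volume B * ∫⁻ z in B, g z := by
  have ht0 : 0 < t := by linarith
  have inner_le : ∀ x ∈ B, ∫⁻ y in B, g (x + t • (y - x)) ≤
      2 ^ Module.finrank ℝ E * ∫⁻ z in B, g z := by
    intro x hx
    calc ∫⁻ y in B, g (x + t • (y - x)) = ∫⁻ y in B, B.indicator g ((x - t • x) + t • y) := by
          refine setLIntegral_congr_fun hB fun y hy => ?_
          have e : x + t • (y - x) = (x - t • x) + t • y := by module
          have hm : x + t • (y - x) ∈ B := hBc.add_smul_sub_mem hx hy ⟨ht0.le, ht1⟩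
          rw [← e, indicator_of_mem hm]
      _ ≤ ∫⁻ y, B.indicator g ((x - t • x) + t • y) := setLIntegral_le_lintegral _ _
      _ = ENNReal.ofReal |(t ^ Module.finrank ℝ E)⁻¹| * ∫⁻ z in B, g z := by
          rw [lintegral_comp_add_smul (hg.indicator hB) _ ht0.ne', lintegral_indicator hB]
      _ ≤ _ := by
          gcongr
          rw [abs_of_pos (by positivity), ← inv_pow, ENNReal.ofReal_pow (by positivity)]
          gcongr
          rw [show (2 : ℝ≥0∞) = ENNReal.ofReal 2 by simp]
          apply ENNReal.ofReal_le_ofReal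
          rw [inv_le_comm₀ ht0 two_pos]
          linarith
  calc _ ≤ ∫⁻ x in B, 2 ^ Module.finrank ℝ E * ∫⁻ z in B, g z :=
        setLIntegral_mono' hB inner_le
    _ = _ := by rw [setLIntegral_const]; ring

/-- Exchanging x and y turns t into 1 - t, so small t reduces to t ≥ 1/2. -/
theorem lintegral_lintegral_segment_le {B : Set E} (hB : MeasurableSet B)
    (hBc : Convex ℝ B) {g : E → ℝ≥0∞} (hg : Measurable g) {t : ℝ} (ht : 0 ≤ t) (ht1 : t ≤ 1) :
    ∫⁻ x in B, ∫⁻ y in B, g (x + t • (y - x)) ≤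
      2 ^ Module.finrank ℝ E * volume B * ∫⁻ z in B, g z := by
  rcases le_total (1 / 2) t with h | h
  · exact lintegral_lintegral_segment_le_of_half_le hB hBc hg h ht1
  · have hm : Measurable (Function.uncurry fun x y : E => g (x + t • (y - x))) := by
      apply hg.comp
      fun_prop
    rw [lintegral_lintegral_swap hm.aemeasurable]
    have := lintegral_lintegral_segment_le_of_half_le hB hBc hg (t := 1 - t) (by linarith)
      (by linarith)
    refine le_trans (le_of_eq ?_) this
    refine lintegral_congr fun y => lintegral_congr fun x => ?_
    congr 1
    module

/-- Poincaré's inequality on balls. -/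
theorem exists_lintegral_closedBall_sub_sq_le {R : ℝ} (hR : 0 < R) :
    ∃ C : ℝ≥0∞, C ≠ ⊤ ∧ ∀ u : E → ℝ, ContDiff ℝ 1 u → ∃ m : ℝ,
      ∫⁻ y in Metric.closedBall 0 R, ‖u y - m‖ₑ ^ 2 ≤
        C * ∫⁻ y in Metric.closedBall 0 R, ‖∇ u y‖ₑ ^ 2 := by
  set B := Metric.closedBall (0 : E) R with hBdef
  have hB : MeasurableSet B := measurableSet_closedBall
  have hBc : Convex ℝ B := convex_closedBall _ _
  have hB0 : volume B ≠ 0 := (Metric.measure_closedBall_pos volume _ hR).ne'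
  have hBt : volume B ≠ ⊤ := (isCompact_closedBall (0 : E) R).measure_lt_top.ne
  set C₀ : ℝ≥0∞ := ENNReal.ofReal (2 * R) ^ 2 * (2 ^ Module.finrank ℝ E * volume B) with hC₀
  have hC₀t : C₀ ≠ ⊤ := ENNReal.mul_ne_top (by finiteness) (by finiteness)
  refine ⟨C₀ / volume B, ENNReal.div_ne_top hC₀t hB0, fun u hu => ?_⟩
  set g : E → ℝ≥0∞ := fun z => ‖∇ u z‖ₑ ^ 2
  have hg : Measurable g := (continuous_gradient hu).measurable.enorm.pow_const 2
  have key : ∫⁻ x in B, ∫⁻ y in B, ‖u y - u x‖ₑ ^ 2 ≤ C₀ * ∫⁻ y in B, g y := by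
    have hm1 : Measurable fun p : (E × E) × ℝ => g (p.1.1 + p.2 • (p.1.2 - p.1.1)) := by
      apply hg.comp
      fun_prop
    have hm2 : ∀ x : E, Measurable (Function.uncurry fun (y : E) (t : ℝ) => g (x + t • (y - x))) :=
      fun x => by
        apply hg.comp
        fun_prop
    calc _ ≤ ∫⁻ x in B, ∫⁻ y in B, ENNReal.ofReal (2 * R) ^ 2 *
          ∫⁻ t in Ioc (0 : ℝ) 1, g (x + t • (y - x)) := by
          refine setLIntegral_mono' hB fun x hx => setLIntegral_mono' hB fun y hy => ?_
          refine (enorm_sub_sq_le_lintegral_segment hu x y).trans ?_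
          gcongr
          rw [← ofReal_norm]
          apply ENNReal.ofReal_le_ofReal
          rw [hBdef, mem_closedBall_zero_iff] at hx hy
          exact (norm_sub_le _ _).trans (by linarith)
      _ = ENNReal.ofReal (2 * R) ^ 2 * ∫⁻ x in B, ∫⁻ y in B,
          ∫⁻ t in Ioc (0 : ℝ) 1, g (x + t • (y - x)) := by
          rw [← lintegral_const_mul' _ _ (by finiteness)]
          refine lintegral_congr fun x => ?_
          rw [← lintegral_const_mul' _ _ (by finiteness)]
      _ = ENNReal.ofReal (2 * R) ^ 2 * ∫⁻ x in B, ∫⁻ t in Ioc (0 : ℝ) 1, ∫⁻ y in B,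
          g (x + t • (y - x)) := by
          congr 1
          exact lintegral_congr fun x => lintegral_lintegral_swap (hm2 x).aemeasurable
      _ = ENNReal.ofReal (2 * R) ^ 2 * ∫⁻ t in Ioc (0 : ℝ) 1, ∫⁻ x in B, ∫⁻ y in B,
          g (x + t • (y - x)) := by
          congr 1
          refine lintegral_lintegral_swap (Measurable.aemeasurable ?_)
          have : Measurable fun p : (E × ℝ) × E => g (p.1.1 + p.1.2 • (p.2 - p.1.1)) := by
            apply hg.comp
            fun_prop
          exact this.lintegral_prod_right'
      _ ≤ ENNReal.ofReal (2 * R) ^ 2 * ∫⁻ t in Ioc (0 : ℝ) 1,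
          (2 ^ Module.finrank ℝ E * volume B * ∫⁻ z in B, g z) := by
          refine mul_le_mul_right ?_ _
          exact setLIntegral_mono' measurableSet_Ioc fun t ht =>
            lintegral_lintegral_segment_le hB hBc hg ht.1.le ht.2
      _ = _ := by
          rw [setLIntegral_const, Real.volume_Ioc, hC₀]
          simp only [sub_zero, ENNReal.ofReal_one, mul_one, mul_assoc]
  have hm3 : Measurable fun x : E => ∫⁻ y in B, ‖u y - u x‖ₑ ^ 2 := by
    have : Measurable fun p : E × E => ‖u p.2 - u p.1‖ₑ ^ 2 :=
      ((hu.continuous.comp continuous_snd).sub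
        (hu.continuous.comp continuous_fst)).measurable.enorm.pow_const 2
    exact this.lintegral_prod_right'
  -- Some x makes the inner integral at most its average over B; u x is then a good enough constant,
  -- and the mean is not needed.
  obtain ⟨x, -, hx⟩ := exists_le_setLAverage hB0 hBt (hm3.aemeasurable)
  refine ⟨u x, hx.trans ?_⟩
  rw [setLAverage_eq, ENNReal.div_eq_inv_mul, ENNReal.div_eq_inv_mul, mul_assoc]
  gcongr

end LocalPoincare

/-! ### Poincaré's inequality for the weighted measure -/

section Poincare

variable {d : ℕ} {V : EuclideanSpace ℝ (Fin d) → ℝ}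

theorem integral_expNeg (hV : Continuous V) (f : EuclideanSpace ℝ (Fin d) → ℝ) :
    ∫ x, f x ∂(expNeg V) = ∫ x, Real.exp (-V x) * f x := by
  have hm : Measurable fun x => ENNReal.ofReal (Real.exp (-V x)) :=
    (Real.continuous_exp.comp hV.neg).measurable.ennreal_ofReal
  rw [expNeg, integral_withDensity_eq_integral_toReal_smul hm
    (ae_of_all _ fun _ => ENNReal.ofReal_lt_top)]
  refine integral_congr_ae (ae_of_all _ fun x => ?_)
  simp [ENNReal.toReal_ofReal (Real.exp_pos _).le]

/-- Subtracting a constant destroys compact support, so the result is kept as an element of H¹(μ);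
compactness in the integration by parts comes from φ alone. -/
theorem memH1_sub_const [IsProbabilityMeasure (expNeg V)] {u : EuclideanSpace ℝ (Fin d) → ℝ}
    (hu : ContDiff ℝ 1 u) (hus : HasCompactSupport u) (m : ℝ) :
    MemH1 (expNeg V) (fun x => u x - m) (∇ u) where
  memLp := (hu.continuous.memLp_of_hasCompactSupport hus).sub (memLp_const m)
  memLp_grad := (continuous_gradient hu).memLp_of_hasCompactSupport (hasCompactSupport_gradient hus)
  isWeakGradient :=
    { locallyIntegrable := (hu.continuous.sub continuous_const).locallyIntegrable
      locallyIntegrable_grad := (continuous_gradient hu).locallyIntegrable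
      integral_eq := fun φ hφ hφs e => by
        have hφ1 : ContDiff ℝ 1 φ := hφ.of_le (by simp)
        have hum : ContDiff ℝ 1 fun x => u x - m := hu.sub contDiff_const
        have hfd : ∀ x, fderiv ℝ (fun x => u x - m) x = fderiv ℝ u x := fun x => by
          rw [fderiv_sub_const]
        have c1 : Continuous fun x => fderiv ℝ φ x e :=
          (hφ1.continuous_fderiv one_ne_zero).clm_apply continuous_const
        have c2 : Continuous fun x => fderiv ℝ (fun x => u x - m) x e :=
          (hum.continuous_fderiv one_ne_zero).clm_apply continuous_const
        have h := integral_mul_fderiv_eq_neg_fderiv_mul_of_integrable (μ := volume)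
          (f := fun x => u x - m) (g := φ) (v := e)
          ((c2.mul hφ1.continuous).integrable_of_hasCompactSupport hφs.mul_left)
          ((hum.continuous.mul c1).integrable_of_hasCompactSupport (hφs.fderiv_apply ℝ e).mul_left)
          ((hum.continuous.mul hφ1.continuous).integrable_of_hasCompactSupport hφs.mul_left)
          (fun x _ => hum.differentiable one_ne_zero x)
          (fun x _ => hφ1.differentiable one_ne_zero x)
        rw [h]
        simp_rw [hfd, inner_gradient_left] }

/-- The Schrödinger potential of `e^{-V} dx` is controlled by the Dirichlet form. -/
theorem integral_sq_mul_potential_le (hV : ContDiff ℝ 2 V) {u : EuclideanSpace ℝ (Fin d) → ℝ}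
    (hu : ContDiff ℝ 1 u) (hus : HasCompactSupport u) :
    ∫ x, u x ^ 2 * ((‖∇ V x‖ ^ 2 - 2 * (Δ V) x) / 4) ∂(expNeg V) ≤ ∫ x, ‖∇ u x‖ ^ 2 ∂(expNeg V) := by
  have h := integral_norm_gradient_mul_exp_sq hV hu hus
  rw [← integral_expNeg hV.continuous, ← integral_expNeg hV.continuous] at h
  have h0 : 0 ≤ ∫ x, ‖∇ (fun y => u y * Real.exp (-V y / 2)) x‖ ^ 2 :=
    integral_nonneg fun x => by positivity
  linarith

/-- Beyond radius R the potential plus c is at least a R², and the form controls the potential. All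
of H¹ is covered because the bound is applied to test functions minus constants. -/
theorem MemH1.mul_setIntegral_compl_closedBall_le [IsProbabilityMeasure (expNeg V)]
    (hV : ContDiff ℝ 2 V) {a c : ℝ} (ha : 0 ≤ a)
    (hQ : ∀ x, a * ‖x‖ ^ 2 - c ≤ (‖∇ V x‖ ^ 2 - 2 * (Δ V) x) / 4)
    {u : EuclideanSpace ℝ (Fin d) → ℝ} {G : EuclideanSpace ℝ (Fin d) → EuclideanSpace ℝ (Fin d)}
    (h : MemH1 (expNeg V) u G) {R : ℝ} (hR : 0 ≤ R) :
    a * R ^ 2 * ∫ x in (Metric.closedBall 0 R)ᶜ, ‖u x‖ ^ 2 ∂(expNeg V) ≤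
      (∫ x, ‖G x‖ ^ 2 ∂(expNeg V)) + c * ∫ x, ‖u x‖ ^ 2 ∂(expNeg V) := by
  obtain ⟨w, hw, hws, hwu, hwG⟩ := h.exists_seq_tendsto hV.continuous
  have hw1 : ∀ n, ContDiff ℝ 1 (w n) := fun n => (hw n).of_le (by simp)
  have mw : ∀ n, MemLp (w n) 2 (expNeg V) := fun n =>
    (hw n).continuous.memLp_of_hasCompactSupport (hws n)
  have mg : ∀ n, MemLp (∇ (w n)) 2 (expNeg V) := fun n =>
    (continuous_gradient (hw1 n)).memLp_of_hasCompactSupport (hasCompactSupport_gradient (hws n))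
  have t1 := tendsto_integral_norm_sq (μ := (expNeg V).restrict (Metric.closedBall 0 R)ᶜ)
    (fun n => (mw n).restrict _) (h.memLp.restrict _)
    (tendsto_of_tendsto_of_tendsto_of_le_of_le tendsto_const_nhds hwu (fun _ => zero_le)
      fun n => eLpNorm_mono_measure _ Measure.restrict_le_self)
  have t2 := tendsto_integral_norm_sq mg h.memLp_grad hwG
  have t3 := tendsto_integral_norm_sq mw h.memLp hwu
  refine le_of_tendsto_of_tendsto' (t1.const_mul (a * R ^ 2)) (t2.add (t3.const_mul c)) fun n => ?_
  have hpot := integral_sq_mul_potential_le hV (hw1 n) (hws n)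
  have hs2 : HasCompactSupport fun x => w n x ^ 2 := (hws n).comp_left (g := fun t => t ^ 2) (by simp)
  have cV := continuous_gradient (hV.of_le (m := 1) (by norm_num))
  have cL := continuous_laplacian hV
  have cw := (hw n).continuous
  have iQ : Integrable (fun x => w n x ^ 2 * ((‖∇ V x‖ ^ 2 - 2 * (Δ V) x) / 4)) (expNeg V) :=
    (show Continuous fun x => w n x ^ 2 * ((‖∇ V x‖ ^ 2 - 2 * (Δ V) x) / 4) by
      fun_prop).integrable_of_hasCompactSupport hs2.mul_right
  have iw : Integrable (fun x => ‖w n x‖ ^ 2) (expNeg V) := (mw n).integrable_norm_pow two_ne_zero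
  have ii : Integrable ((Metric.closedBall 0 R)ᶜ.indicator fun x => ‖w n x‖ ^ 2) (expNeg V) :=
    iw.indicator measurableSet_closedBall.compl
  have hle : a * R ^ 2 * (∫ x in (Metric.closedBall 0 R)ᶜ, ‖w n x‖ ^ 2 ∂(expNeg V)) -
      c * ∫ x, ‖w n x‖ ^ 2 ∂(expNeg V) ≤
      ∫ x, w n x ^ 2 * ((‖∇ V x‖ ^ 2 - 2 * (Δ V) x) / 4) ∂(expNeg V) := by
    rw [← integral_indicator measurableSet_closedBall.compl, ← integral_const_mul,
      ← integral_const_mul, ← integral_sub (ii.const_mul _) (iw.const_mul _)]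
    refine integral_mono ((ii.const_mul _).sub (iw.const_mul _)) iQ fun x => ?_
    have hsq : 0 ≤ w n x ^ 2 := sq_nonneg _
    have h1 := mul_le_mul_of_nonneg_left (hQ x) hsq
    simp only [Real.norm_eq_abs, sq_abs]
    by_cases hx : x ∈ (Metric.closedBall (0 : EuclideanSpace ℝ (Fin d)) R)ᶜ
    · rw [indicator_of_mem hx]
      have hRx : R ^ 2 ≤ ‖x‖ ^ 2 := by
        have : R < ‖x‖ := by simpa using hx
        gcongr
      have h2 : a * R ^ 2 * w n x ^ 2 ≤ a * ‖x‖ ^ 2 * w n x ^ 2 := by gcongr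
      linarith
    · rw [indicator_of_notMem hx]
      have h2 : 0 ≤ a * ‖x‖ ^ 2 * w n x ^ 2 := by positivity
      linarith
  linarith

/-- The weight is comparable to Lebesgue measure on the ball; each side of the Euclidean inequality
costs one comparison constant. -/
theorem exists_setIntegral_closedBall_sub_sq_le [IsProbabilityMeasure (expNeg V)]
    (hV : Continuous V) {R : ℝ} (hR : 0 < R) :
    ∃ C : ℝ, 0 ≤ C ∧ ∀ u : EuclideanSpace ℝ (Fin d) → ℝ, ContDiff ℝ 1 u → HasCompactSupport u →
      ∃ m : ℝ, ∫ x in Metric.closedBall 0 R, ‖u x - m‖ ^ 2 ∂(expNeg V) ≤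
        C * ∫ x, ‖∇ u x‖ ^ 2 ∂(expNeg V) := by
  obtain ⟨c, hct, hc0, hle1, hle2⟩ := exists_expNeg_restrict_le hV R
  obtain ⟨C, hC, hCu⟩ := exists_lintegral_closedBall_sub_sq_le (E := EuclideanSpace ℝ (Fin d)) hR
  refine ⟨(c * (C * c)).toReal, ENNReal.toReal_nonneg, fun u hu hus => ?_⟩
  obtain ⟨m, hm⟩ := hCu u hu
  refine ⟨m, ?_⟩
  have hH := memH1_sub_const (V := V) hu hus m
  rw [integral_norm_sq_eq_toReal_eLpNorm (hH.memLp.restrict _),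
    integral_norm_sq_eq_toReal_eLpNorm hH.memLp_grad, ← ENNReal.toReal_pow, ← ENNReal.toReal_pow,
    ← ENNReal.toReal_mul]
  refine ENNReal.toReal_mono (ENNReal.mul_ne_top (by finiteness)
    (ENNReal.pow_ne_top hH.memLp_grad.eLpNorm_ne_top)) ?_
  rw [eLpNorm_two_sq, eLpNorm_two_sq]
  calc _ ≤ ∫⁻ x, ‖u x - m‖ₑ ^ 2 ∂(c • volume.restrict (Metric.closedBall 0 R)) :=
        lintegral_mono' hle1 le_rfl
    _ = c * ∫⁻ x in Metric.closedBall 0 R, ‖u x - m‖ₑ ^ 2 := by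
        rw [lintegral_smul_measure, smul_eq_mul]
    _ ≤ c * (C * ∫⁻ x, ‖∇ u x‖ₑ ^ 2 ∂(c • (expNeg V).restrict (Metric.closedBall 0 R))) := by
        gcongr
        exact hm.trans (mul_le_mul_right (lintegral_mono' hle2 le_rfl) _)
    _ = c * (C * c) * ∫⁻ x in Metric.closedBall 0 R, ‖∇ u x‖ₑ ^ 2 ∂(expNeg V) := by
        rw [lintegral_smul_measure, smul_eq_mul]; ring
    _ ≤ _ := by gcongr; exact Measure.restrict_le_self

theorem variance_expand {α : Type*} [MeasurableSpace α] {μ : Measure α} [IsProbabilityMeasure μ]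
    {u : α → ℝ} (hu : MemLp u 2 μ) (m : ℝ) :
    ∫ x, ‖u x - m‖ ^ 2 ∂μ = (∫ x, u x ^ 2 ∂μ) - 2 * m * (∫ x, u x ∂μ) + m ^ 2 := by
  have i1 : Integrable (fun x => u x ^ 2) μ := hu.integrable_sq
  have i2 : Integrable (fun x => 2 * m * u x) μ := (hu.integrable one_le_two).const_mul _
  have e : ∀ x, ‖u x - m‖ ^ 2 = u x ^ 2 - 2 * m * u x + m ^ 2 := fun x => by
    rw [Real.norm_eq_abs, sq_abs]; ring
  have i12 : Integrable (fun x => u x ^ 2 - 2 * m * u x) μ := i1.sub i2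
  simp_rw [e]
  rw [integral_add i12 (integrable_const _), integral_sub i1 i2, integral_const_mul]
  simp

/-- The Poincaré inequality for `e^{-V} dx` when its Schrödinger potential grows quadratically. -/
theorem exists_poincare [IsProbabilityMeasure (expNeg V)]
    (hV : ContDiff ℝ 2 V) {a c : ℝ} (ha : 0 < a)
    (hQ : ∀ x, a * ‖x‖ ^ 2 - c ≤ (‖∇ V x‖ ^ 2 - 2 * (Δ V) x) / 4) :
    ∃ C : ℝ, 0 ≤ C ∧ ∀ u G, MemH1 (expNeg V) u G →
      (∫ x, u x ^ 2 ∂(expNeg V)) - (∫ x, u x ∂(expNeg V)) ^ 2 ≤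
        C * ∫ x, ‖G x‖ ^ 2 ∂(expNeg V) := by
  set c' := max c 0 with hc'
  have hc0 : 0 ≤ c' := le_max_right _ _
  have hQ' : ∀ x, a * ‖x‖ ^ 2 - c' ≤ (‖∇ V x‖ ^ 2 - 2 * (Δ V) x) / 4 := fun x =>
    (by linarith [le_max_left c 0] : a * ‖x‖ ^ 2 - c' ≤ a * ‖x‖ ^ 2 - c).trans (hQ x)
  -- With a R² = 2c' + 1, the exterior bound reads (2c' + 1)B ≤ D + c'(A + B), where A and B are the
  -- inner and outer integrals and D the energy. The c'B is absorbed, giving B ≤ A + D, so the total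
  -- is at most 2A + D ≤ (2C + 1)D.
  set R := Real.sqrt ((2 * c' + 1) / a) with hR
  have hRpos : 0 < R := Real.sqrt_pos.2 (by positivity)
  have hR2 : a * R ^ 2 = 2 * c' + 1 := by
    rw [hR, Real.sq_sqrt (by positivity)]; field_simp
  obtain ⟨C, hC, hCu⟩ := exists_setIntegral_closedBall_sub_sq_le hV.continuous hRpos
  refine ⟨2 * C + 1, by positivity, fun u G h => ?_⟩
  obtain ⟨w, hw, hws, hwu, hwG⟩ := h.exists_seq_tendsto hV.continuous
  have hw1 : ∀ n, ContDiff ℝ 1 (w n) := fun n => (hw n).of_le (by simp)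
  have mw : ∀ n, MemLp (w n) 2 (expNeg V) := fun n =>
    (hw n).continuous.memLp_of_hasCompactSupport (hws n)
  have mg : ∀ n, MemLp (∇ (w n)) 2 (expNeg V) := fun n =>
    (continuous_gradient (hw1 n)).memLp_of_hasCompactSupport (hasCompactSupport_gradient (hws n))
  have t1 := tendsto_integral_norm_sq mw h.memLp hwu
  simp only [Real.norm_eq_abs, sq_abs] at t1
  have t2 := tendsto_integral_norm_sq mg h.memLp_grad hwG
  have t3 := tendsto_integral_of_tendsto_eLpNorm_two mw h.memLp hwu
  refine le_of_tendsto_of_tendsto' (t1.sub (t3.pow 2)) (t2.const_mul (2 * C + 1)) fun n => ?_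
  obtain ⟨m, hm⟩ := hCu (w n) (hw1 n) (hws n)
  have hH := memH1_sub_const (V := V) (hw1 n) (hws n) m
  have h1 := hH.mul_setIntegral_compl_closedBall_le hV ha.le hQ' hRpos.le
  have hsplit := integral_add_compl (μ := expNeg V) (s := Metric.closedBall 0 R)
    measurableSet_closedBall (hH.memLp.integrable_norm_pow two_ne_zero)
  have hvar := variance_expand (mw n) m
  have hB0 : 0 ≤ ∫ x in Metric.closedBall 0 R, ‖w n x - m‖ ^ 2 ∂(expNeg V) :=
    integral_nonneg fun x => by positivity
  have hG0 : 0 ≤ ∫ x, ‖∇ (w n) x‖ ^ 2 ∂(expNeg V) := integral_nonneg fun x => by positivity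
  rw [hR2] at h1
  set A := ∫ x in Metric.closedBall 0 R, ‖w n x - m‖ ^ 2 ∂(expNeg V)
  set B := ∫ x in (Metric.closedBall 0 R)ᶜ, ‖w n x - m‖ ^ 2 ∂(expNeg V)
  set D := ∫ x, ‖∇ (w n) x‖ ^ 2 ∂(expNeg V)
  have hB : B ≤ A + D := by
    have : (c' + 1) * B ≤ (c' + 1) * (A + D) := by
      rw [← hsplit] at h1
      nlinarith [mul_nonneg hc0 hG0]
    exact le_of_mul_le_mul_left this (by positivity)
  -- The variance is at most ∫(w - m)² for any m; the gap is the square supplied here.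
  nlinarith [sq_nonneg ((∫ x, w n x ∂(expNeg V)) - m)]

end Poincare

/-! ### From Poincaré to the generalized Poincaré inequality -/

section GeneralizedPoincare

/-- Jensen for t ↦ t^{2/p}, convex as p ≤ 2, applied to |u|, then raised to the power p. The bound
2/p ≤ 2 provides integrability. -/
theorem rpow_integral_abs_ge {α : Type*} [MeasurableSpace α] {μ : Measure α}
    [IsProbabilityMeasure μ] {u : α → ℝ} (hu : MemLp u 2 μ) {p : ℝ} (hp : 1 ≤ p) (hp2 : p ≤ 2) :
    (∫ x, u x ∂μ) ^ 2 ≤ (∫ x, |u x| ^ (2 / p) ∂μ) ^ p := by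
  have hp0 : 0 < p := by linarith
  have hq1 : 1 ≤ 2 / p := by rwa [le_div_iff₀ hp0, one_mul]
  have hq2 : 2 / p ≤ 2 := by rw [div_le_iff₀ hp0]; linarith
  have hq : MemLp u (ENNReal.ofReal (2 / p)) μ := hu.mono_exponent (by
    rw [show (2 : ℝ≥0∞) = ENNReal.ofReal 2 by simp]; exact ENNReal.ofReal_le_ofReal hq2)
  have iq : Integrable (fun x => |u x| ^ (2 / p)) μ := by
    have := hq.integrable_norm_rpow (by simp; positivity) (by simp)
    rw [ENNReal.toReal_ofReal (by positivity)] at this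
    exact this
  have jensen : (∫ x, |u x| ∂μ) ^ (2 / p) ≤ ∫ x, |u x| ^ (2 / p) ∂μ :=
    (convexOn_rpow hq1).map_integral_le
      ((Real.continuous_rpow_const (by positivity)).continuousOn) isClosed_Ici
      (ae_of_all _ fun x => abs_nonneg (u x)) (hu.integrable one_le_two).abs iq
  have h0 : 0 ≤ ∫ x, |u x| ∂μ := integral_nonneg fun x => abs_nonneg _
  calc (∫ x, u x ∂μ) ^ 2 ≤ (∫ x, |u x| ∂μ) ^ 2 := by
        rw [← sq_abs]
        gcongr
        exact abs_integral_le_integral_abs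
    _ = ((∫ x, |u x| ∂μ) ^ (2 / p)) ^ p := by
        rw [← Real.rpow_mul h0, div_mul_cancel₀ _ hp0.ne', Real.rpow_two]
    _ ≤ _ := Real.rpow_le_rpow (by positivity) jensen hp0.le

theorem generalizedPoincare_of_poincare {d : ℕ} {μ : Measure (EuclideanSpace ℝ (Fin d))}
    [IsProbabilityMeasure μ] {C : ℝ}
    (hC : ∀ u G, MemH1 μ u G → (∫ x, u x ^ 2 ∂μ) - (∫ x, u x ∂μ) ^ 2 ≤ C * ∫ x, ‖G x‖ ^ 2 ∂μ)
    {p : ℝ} (hp : 1 < p) (hp2 : p ≤ 2) : GeneralizedPoincare p μ := by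
  refine ⟨1 / (p - 1) * C, fun u G h => ?_⟩
  have hp1 : 0 < p - 1 := by linarith
  have h1 := hC u G h
  have h2 := rpow_integral_abs_ge h.memLp hp.le hp2
  rw [mul_assoc]
  refine mul_le_mul_of_nonneg_left ?_ (by positivity)
  simp only [sq_abs]
  linarith

end GeneralizedPoincare

/-! ### Sobolev and logarithmic Sobolev inequalities for Lebesgue measure -/

section Sobolev

variable {d : ℕ}

/-- By 2ab ≤ a² + b², the H¹ norm of w controls the L¹ norm of ∇(w²), so L¹ Sobolev estimates can be
applied to w². -/
theorem norm_gradient_sq_le {E : Type*} [NormedAddCommGroup E] [InnerProductSpace ℝ E]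
    [CompleteSpace E] {w : E → ℝ} {x : E} (hw : DifferentiableAt ℝ w x) :
    ‖∇ (fun y => w y ^ 2) x‖ ≤ w x ^ 2 + ‖∇ w x‖ ^ 2 := by
  rw [gradient_sq hw, norm_smul, Real.norm_eq_abs, abs_mul, abs_two]
  nlinarith [sq_nonneg (|w x| - ‖∇ w x‖), sq_abs (w x)]

theorem integrable_sq_add_norm_gradient_sq {w : EuclideanSpace ℝ (Fin d) → ℝ}
    (hw : ContDiff ℝ 1 w) (hws : HasCompactSupport w) :
    Integrable (fun x => w x ^ 2) ∧ Integrable (fun x => ‖∇ w x‖ ^ 2) := by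
  have h1 : MemLp w 2 volume := hw.continuous.memLp_of_hasCompactSupport hws
  have h2 : MemLp (∇ w) 2 volume :=
    (continuous_gradient hw).memLp_of_hasCompactSupport (hasCompactSupport_gradient hws)
  exact ⟨h1.integrable_sq, h2.integrable_norm_pow two_ne_zero⟩

theorem sq_le_integral_of_dim_zero (w : EuclideanSpace ℝ (Fin 0) → ℝ)
    (x : EuclideanSpace ℝ (Fin 0)) : w x ^ 2 ≤ (∫ y, w y ^ 2) + ∫ y, ‖∇ w y‖ ^ 2 := by
  have h : 0 ≤ ∫ y, ‖∇ w y‖ ^ 2 := integral_nonneg fun y => by positivity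
  have e : ∫ y, w y ^ 2 = w x ^ 2 := by
    rw [volume_euclideanSpace_eq_dirac, integral_dirac, Subsingleton.elim x 0]
  linarith

theorem sq_le_integral_of_dim_one {w : EuclideanSpace ℝ (Fin 1) → ℝ}
    (hw : ContDiff ℝ 1 w) (hws : HasCompactSupport w) (x : EuclideanSpace ℝ (Fin 1)) :
    w x ^ 2 ≤ (∫ y, w y ^ 2) + ∫ y, ‖∇ w y‖ ^ 2 := by
  let L : ℝ ≃ₗᵢ[ℝ] EuclideanSpace ℝ (Fin 1) := (OrthonormalBasis.singleton (Fin 1) ℝ).repr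
  have hL : MeasurePreserving L volume volume := L.measurePreserving
  have hw2 : ContDiff ℝ 1 fun y => w y ^ 2 := hw.pow 2
  have hf : ContDiff ℝ 1 fun t => w (L t) ^ 2 := hw2.comp L.toContinuousLinearEquiv.contDiff
  have hw2s : HasCompactSupport fun y => w y ^ 2 := hws.comp_left (g := fun t => t ^ 2) (by simp)
  have hfs : HasCompactSupport fun t => w (L t) ^ 2 :=
    hw2s.comp_homeomorph L.toHomeomorph
  have hderiv : ∀ t, ‖deriv (fun t => w (L t) ^ 2) t‖ ≤ w (L t) ^ 2 + ‖∇ w (L t)‖ ^ 2 := fun t => by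
    have h1 : HasDerivAt L (L 1) t := L.toContinuousLinearEquiv.toContinuousLinearMap.hasDerivAt
    have h2 : HasDerivAt (fun t => w (L t) ^ 2) _ t :=
      ((hw2.differentiable one_ne_zero) (L t)).hasFDerivAt.comp_hasDerivAt t h1
    rw [h2.deriv]
    refine (ContinuousLinearMap.le_opNorm _ _).trans ?_
    rw [← norm_gradient, L.norm_map, norm_one, mul_one]
    exact norm_gradient_sq_le (hw.differentiable one_ne_zero _)
  obtain ⟨i1, i2⟩ := integrable_sq_add_norm_gradient_sq hw hws
  have hpos : 0 ≤ (∫ y, w y ^ 2) + ∫ y, ‖∇ w y‖ ^ 2 :=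
    add_nonneg (integral_nonneg fun y => by positivity) (integral_nonneg fun y => by positivity)
  have key := HasCompactSupport.enorm_le_lintegral_Ici_deriv hf hfs (L.symm x)
  simp only [L.apply_symm_apply] at key
  rw [Real.enorm_of_nonneg (sq_nonneg _)] at key
  rw [← ENNReal.ofReal_le_ofReal_iff hpos]
  calc _ ≤ _ := key
    _ ≤ ∫⁻ t, ENNReal.ofReal (w (L t) ^ 2 + ‖∇ w (L t)‖ ^ 2) := by
        refine (setLIntegral_le_lintegral _ _).trans (lintegral_mono fun t => ?_)
        rw [← ofReal_norm]
        exact ENNReal.ofReal_le_ofReal (hderiv t)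
    _ = ∫⁻ y, ENNReal.ofReal (w y ^ 2 + ‖∇ w y‖ ^ 2) :=
        hL.lintegral_comp_emb L.toHomeomorph.measurableEmbedding
          (fun y => ENNReal.ofReal (w y ^ 2 + ‖∇ w y‖ ^ 2))
    _ = _ := by
        rw [← integral_add i1 i2]
        exact (ofReal_integral_eq_lintegral_ofReal (f := fun y => w y ^ 2 + ‖∇ w y‖ ^ 2) (i1.add i2)
          (ae_of_all _ fun y => by positivity)).symm

/-- The Gagliardo–Nirenberg–Sobolev inequality from L¹ to L^{d/(d-1)}, applied to w²; θ = d/(d-1) is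
the conjugate exponent of d. -/
theorem integral_sq_rpow_le_of_two_le (hd : 2 ≤ d) :
    ∃ θ : ℝ, 1 < θ ∧ ∃ K : ℝ, 0 < K ∧ ∀ w : EuclideanSpace ℝ (Fin d) → ℝ, ContDiff ℝ 1 w →
      HasCompactSupport w →
      ∫ x, (w x ^ 2) ^ θ ≤ K * ((∫ x, w x ^ 2) + ∫ x, ‖∇ w x‖ ^ 2) ^ θ := by
  have hd1 : (1 : NNReal) < d := by exact_mod_cast hd
  have hconj : NNReal.HolderConjugate (Module.finrank ℝ (EuclideanSpace ℝ (Fin d)))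
      (NNReal.conjExponent d) := by
    rw [finrank_euclideanSpace_fin]
    exact NNReal.HolderConjugate.conjExponent hd1
  set θ : NNReal := NNReal.conjExponent d with hθ
  have hθ1 : (1 : ℝ) < θ := by exact_mod_cast hconj.symm.lt
  have hθ0 : (0 : ℝ) < θ := by linarith
  set c : NNReal := eLpNormLESNormFDerivOneConst (volume : Measure (EuclideanSpace ℝ (Fin d))) θ
  refine ⟨θ, hθ1, (c : ℝ) ^ (θ : ℝ) + 1, by positivity, fun w hw hws => ?_⟩
  have hw2 : ContDiff ℝ 1 fun y => w y ^ 2 := hw.pow 2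
  have hw2s : HasCompactSupport fun y => w y ^ 2 := hws.comp_left (g := fun t => t ^ 2) (by simp)
  obtain ⟨i1, i2⟩ := integrable_sq_add_norm_gradient_sq hw hws
  set S := (∫ y, w y ^ 2) + ∫ y, ‖∇ w y‖ ^ 2 with hS
  have hpos : 0 ≤ S :=
    add_nonneg (integral_nonneg fun y => by positivity) (integral_nonneg fun y => by positivity)
  have gns := eLpNorm_le_eLpNorm_fderiv_one volume hw2 hw2s hconj
  have hgrad : eLpNorm (fderiv ℝ fun y => w y ^ 2) 1 volume ≤ ENNReal.ofReal S := by
    rw [eLpNorm_one_eq_lintegral_enorm, hS, ← integral_add i1 i2,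
      ofReal_integral_eq_lintegral_ofReal (f := fun y => w y ^ 2 + ‖∇ w y‖ ^ 2) (i1.add i2) (ae_of_all _ fun y => by positivity)]
    refine lintegral_mono fun y => ?_
    rw [← ofReal_norm, ← norm_gradient]
    exact ENNReal.ofReal_le_ofReal (norm_gradient_sq_le (hw.differentiable one_ne_zero _))
  have hpow := eLpNorm_nnreal_pow_eq_lintegral (μ := (volume : Measure (EuclideanSpace ℝ (Fin d))))
    (f := fun y => w y ^ 2) (p := θ) (by exact_mod_cast hθ0.ne')
  have hint : ∫ x, (w x ^ 2) ^ (θ : ℝ) = (∫⁻ x, ‖w x ^ 2‖ₑ ^ (θ : ℝ)).toReal := by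
    rw [integral_eq_lintegral_of_nonneg_ae (ae_of_all _ fun x => by positivity)
      ((hw2.continuous.rpow_const fun _ => Or.inr hθ0.le).aestronglyMeasurable)]
    congr 1
    refine lintegral_congr fun x => ?_
    rw [← ENNReal.ofReal_rpow_of_nonneg (sq_nonneg _) hθ0.le, Real.enorm_of_nonneg (sq_nonneg _)]
  rw [hint, ← hpow]
  have hle : eLpNorm (fun y => w y ^ 2) θ volume ^ (θ : ℝ) ≤
      ENNReal.ofReal ((c : ℝ) ^ (θ : ℝ) * S ^ (θ : ℝ)) := by
    rw [← Real.mul_rpow c.coe_nonneg hpos, ← ENNReal.ofReal_rpow_of_nonneg (by positivity) hθ0.le]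
    refine ENNReal.rpow_le_rpow (gns.trans ?_) hθ0.le
    rw [ENNReal.ofReal_mul c.coe_nonneg, ENNReal.ofReal_coe_nnreal]
    gcongr
  refine (ENNReal.toReal_le_of_le_ofReal (by positivity) hle).trans ?_
  gcongr
  linarith

/-- A Sobolev embedding `H¹ ⊆ L^{2θ}` with some `θ > 1`, in every dimension. -/
theorem exists_sobolev (d : ℕ) :
    ∃ θ : ℝ, 1 < θ ∧ ∃ K : ℝ, 0 < K ∧ ∀ w : EuclideanSpace ℝ (Fin d) → ℝ, ContDiff ℝ 1 w →
      HasCompactSupport w →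
      ∫ x, (w x ^ 2) ^ θ ≤ K * ((∫ x, w x ^ 2) + ∫ x, ‖∇ w x‖ ^ 2) ^ θ := by
  by_cases hd : 2 ≤ d
  · exact integral_sq_rpow_le_of_two_le hd
  -- In dimensions 0 and 1, w² is bounded by the squared H¹ norm, and ∫ w⁴ ≤ (sup w²) ∫ w².
  · refine ⟨2, one_lt_two, 1, one_pos, fun w hw hws => ?_⟩
    have hsup : ∀ x, w x ^ 2 ≤ (∫ y, w y ^ 2) + ∫ y, ‖∇ w y‖ ^ 2 := by
      obtain rfl | rfl : d = 0 ∨ d = 1 := by omega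
      · exact sq_le_integral_of_dim_zero w
      · exact sq_le_integral_of_dim_one hw hws
    obtain ⟨i1, -⟩ := integrable_sq_add_norm_gradient_sq hw hws
    have hD : 0 ≤ ∫ y, ‖∇ w y‖ ^ 2 := integral_nonneg fun y => by positivity
    have hN : 0 ≤ ∫ y, w y ^ 2 := integral_nonneg fun y => by positivity
    have h4 : Integrable fun x => (w x ^ 2) ^ (2 : ℝ) := by
      have hs : HasCompactSupport fun x => (w x ^ 2) ^ (2 : ℝ) :=
        hws.comp_left (g := fun t => (t ^ 2) ^ (2 : ℝ)) (by simp)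
      exact ((hw.continuous.pow 2).rpow_const fun _ => Or.inr zero_le_two).integrable_of_hasCompactSupport
        hs
    calc _ ≤ ∫ x, ((∫ y, w y ^ 2) + ∫ y, ‖∇ w y‖ ^ 2) * w x ^ 2 := by
          refine integral_mono h4 (i1.const_mul _) fun x => ?_
          simp only [Real.rpow_two]
          rw [sq (w x ^ 2)]
          exact mul_le_mul_of_nonneg_right (hsup x) (sq_nonneg _)
      _ ≤ _ := by
          rw [integral_const_mul, one_mul, Real.rpow_two, sq]
          gcongr
          linarith

/-- A Euclidean logarithmic Sobolev inequality with an arbitrarily chosen gradient constant. -/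
theorem exists_euclidean_logSobolev (d : ℕ) {A : ℝ} (hA : 0 < A) :
    ∃ B : ℝ, ∀ w : EuclideanSpace ℝ (Fin d) → ℝ, ContDiff ℝ 1 w → HasCompactSupport w →
      ∫ x, w x ^ 2 * Real.log (w x ^ 2) ≤
        A * (∫ x, ‖∇ w x‖ ^ 2) + B * (∫ x, w x ^ 2) +
          (∫ x, w x ^ 2) * Real.log (∫ x, w x ^ 2) := by
  obtain ⟨θ, hθ, K, hK, hS⟩ := exists_sobolev d
  have hθ1 : 0 < θ - 1 := by linarith
  have hθ0 : 0 < θ := by linarith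
  -- The logarithm of (N + D)/N is linearised by log y ≤ εy - 1 - log ε; this ε makes the resulting
  -- coefficient θε/(θ - 1) of D equal to A.
  set ε := A * (θ - 1) / θ with hε
  have hε0 : 0 < ε := by positivity
  refine ⟨(Real.log K + θ * ε - θ - θ * Real.log ε) / (θ - 1), fun w hw hws => ?_⟩
  obtain ⟨i1, -⟩ := integrable_sq_add_norm_gradient_sq hw hws
  have hs := hS w hw hws
  have hD : 0 ≤ ∫ y, ‖∇ w y‖ ^ 2 := integral_nonneg fun y => by positivity
  have hN : 0 ≤ ∫ y, w y ^ 2 := integral_nonneg fun y => by positivity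
  have i2 : Integrable fun x => (w x ^ 2) ^ θ := by
    have hs : HasCompactSupport fun x => (w x ^ 2) ^ θ :=
      hws.comp_left (g := fun t => (t ^ 2) ^ θ) (by simp [hθ0.ne'])
    exact ((hw.continuous.pow 2).rpow_const fun _ => Or.inr hθ0.le).integrable_of_hasCompactSupport hs
  have i3 : Integrable fun x => w x ^ 2 * Real.log (w x ^ 2) := by
    have hs : HasCompactSupport fun x => w x ^ 2 * Real.log (w x ^ 2) :=
      hws.comp_left (g := fun t => t ^ 2 * Real.log (t ^ 2)) (by simp)
    exact (Real.continuous_mul_log.comp (hw.continuous.pow 2)).integrable_of_hasCompactSupport hs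
  set N := ∫ y, w y ^ 2 with hNdef
  set D := ∫ y, ‖∇ w y‖ ^ 2 with hDdef
  rcases hN.eq_or_lt with hN0 | hNpos
  · have hae := (integral_eq_zero_iff_of_nonneg (fun x => sq_nonneg (w x)) i1).1 hN0.symm
    have : ∫ x, w x ^ 2 * Real.log (w x ^ 2) = 0 := by
      refine integral_eq_zero_of_ae ?_
      filter_upwards [hae] with x hx
      simp only [Pi.zero_apply] at hx
      simp [hx]
    rw [this, ← hN0]
    simp only [mul_zero, zero_mul, add_zero]
    positivity
  -- Apply log y ≤ y - 1 to y = s^{θ-1}/a with s = w². By Sobolev, this a makes a⁻¹∫s^θ ≤ N, so the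
  -- y - 1 part integrates to at most 0, leaving N log a.
  set a := K * (N + D) ^ θ / N with ha
  have ha0 : 0 < a := by positivity
  have pt : ∀ s : ℝ, 0 ≤ s → (θ - 1) * (s * Real.log s) ≤ a⁻¹ * s ^ θ - s + Real.log a * s := by
    intro s hs
    rcases hs.eq_or_lt with rfl | hs
    · simp [Real.zero_rpow hθ0.ne']
    · have h1 := Real.log_le_sub_one_of_pos (show 0 < s ^ (θ - 1) / a by positivity)
      rw [Real.log_div (by positivity) ha0.ne', Real.log_rpow hs] at h1
      have h2 : s * s ^ (θ - 1) = s ^ θ := by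
        rw [mul_comm, ← Real.rpow_add_one hs.ne']; congr 1; ring
      have h3 := mul_le_mul_of_nonneg_left h1 hs.le
      have h4 : s * (s ^ (θ - 1) / a - 1) = a⁻¹ * s ^ θ - s := by rw [← h2]; ring
      rw [h4] at h3
      linarith
  have i4 : Integrable fun x => a⁻¹ * (w x ^ 2) ^ θ - w x ^ 2 := (i2.const_mul _).sub i1
  have hint : (θ - 1) * ∫ x, w x ^ 2 * Real.log (w x ^ 2) ≤
      a⁻¹ * (∫ x, (w x ^ 2) ^ θ) - N + Real.log a * N := by
    rw [← integral_const_mul, ← integral_const_mul, hNdef, ← integral_sub (i2.const_mul _) i1,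
      ← integral_const_mul, ← integral_add i4 (i1.const_mul _)]
    exact integral_mono (i3.const_mul _) (i4.add (i1.const_mul _)) fun x => pt _ (sq_nonneg _)
  have h1 : a⁻¹ * (∫ x, (w x ^ 2) ^ θ) ≤ N := by
    rw [inv_mul_le_iff₀ ha0, ha, div_mul_cancel₀ _ hNpos.ne']
    exact hs
  have hND : 0 < N + D := by linarith
  have hloga : Real.log a = Real.log K + θ * Real.log (N + D) - Real.log N := by
    rw [ha, Real.log_div (by positivity) hNpos.ne', Real.log_mul hK.ne' (by positivity),
      Real.log_rpow hND]
  have h2 := Real.log_le_sub_one_of_pos (show 0 < ε * ((N + D) / N) by positivity)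
  rw [Real.log_mul hε0.ne' (by positivity), Real.log_div hND.ne' hNpos.ne'] at h2
  have h3 : N * (θ * (Real.log (N + D) - Real.log N)) ≤
      θ * ε * (N + D) - N * θ - N * θ * Real.log ε := by
    have h5 : Real.log (N + D) - Real.log N ≤ ε * ((N + D) / N) - 1 - Real.log ε := by linarith
    have h6 := mul_le_mul_of_nonneg_left h5 (show 0 ≤ N * θ by positivity)
    have h7 : N * θ * (ε * ((N + D) / N) - 1 - Real.log ε) =
        θ * ε * (N + D) - N * θ - N * θ * Real.log ε := by
      field_simp
    linarith
  have hθε : θ * ε = A * (θ - 1) := by rw [hε]; field_simp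
  rw [← mul_le_mul_iff_right₀ hθ1]
  calc _ ≤ Real.log a * N := by linarith
    _ = N * Real.log K + N * (θ * (Real.log (N + D) - Real.log N)) +
        (θ - 1) * (N * Real.log N) := by rw [hloga]; ring
    _ ≤ N * Real.log K + (θ * ε * (N + D) - N * θ - N * θ * Real.log ε) +
        (θ - 1) * (N * Real.log N) := by linarith
    _ = (θ * ε) * D + (Real.log K + θ * ε - θ - θ * Real.log ε) * N +
        (θ - 1) * (N * Real.log N) := by ring
    _ = _ := by
        conv_lhs => rw [show θ * ε * D = A * (θ - 1) * D by rw [hθε]]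
        field_simp

end Sobolev

/-! ### Defective and tight logarithmic Sobolev inequalities for μ -/

section LogSobolev

theorem mul_log_add_one_nonneg {s : ℝ} (hs : 0 ≤ s) : 0 ≤ s * Real.log s + 1 := by
  rcases hs.eq_or_lt with rfl | hs
  · simp
  · have h := mul_le_mul_of_nonneg_left (Real.one_sub_inv_le_log_of_pos hs) hs.le
    rw [mul_sub, mul_inv_cancel₀ hs.ne'] at h
    linarith

variable {d : ℕ} {V : EuclideanSpace ℝ (Fin d) → ℝ}

/-- A defective logarithmic Sobolev inequality for test functions, from the Euclidean one by the
ground state transform. -/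
theorem exists_defective_logSobolev_of_hasCompactSupport
    (hV : ContDiff ℝ 2 V) {A c : ℝ} (hA : 0 < A)
    (hVQ : ∀ x, V x ≤ A * ((‖∇ V x‖ ^ 2 - 2 * (Δ V) x) / 4) + c) :
    ∃ B : ℝ, ∀ u : EuclideanSpace ℝ (Fin d) → ℝ, ContDiff ℝ 1 u → HasCompactSupport u →
      ∫ x, u x ^ 2 * Real.log (u x ^ 2) ∂(expNeg V) ≤
        A * (∫ x, ‖∇ u x‖ ^ 2 ∂(expNeg V)) + B * (∫ x, u x ^ 2 ∂(expNeg V)) +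
          (∫ x, u x ^ 2 ∂(expNeg V)) * Real.log (∫ x, u x ^ 2 ∂(expNeg V)) := by
  obtain ⟨B, hB⟩ := exists_euclidean_logSobolev d hA
  refine ⟨B + c, fun u hu hus => ?_⟩
  have hV1 : ContDiff ℝ 1 V := hV.of_le (by norm_num)
  -- Here w² log w² dx = u² log u² dμ - u² V dμ, while A|∇w|² contributes -A ∫u² Q dμ; `hVQ` lets
  -- the latter pay for the former.
  obtain ⟨w, hw⟩ : ∃ w : EuclideanSpace ℝ (Fin d) → ℝ, w = fun x => u x * Real.exp (-V x / 2) :=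
    ⟨_, rfl⟩
  have hwc : ContDiff ℝ 1 w := by rw [hw]; exact hu.mul ((hV1.neg).div_const 2).exp
  have hws : HasCompactSupport w := by rw [hw]; exact hus.mul_right
  have hls := hB w hwc hws
  have hgs := integral_norm_gradient_mul_exp_sq hV hu hus
  rw [← hw] at hgs
  have hwsq : ∀ x, w x ^ 2 = Real.exp (-V x) * u x ^ 2 := fun x => by
    have he : Real.exp (-V x) = Real.exp (-V x / 2) ^ 2 := by
      rw [← Real.exp_nat_mul]; congr 1; push_cast; ring
    rw [hw, he]; ring
  have hN : ∫ x, w x ^ 2 = ∫ x, u x ^ 2 ∂(expNeg V) := by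
    rw [integral_expNeg hV.continuous]
    exact integral_congr_ae (ae_of_all _ hwsq)
  have cV := continuous_gradient hV1
  have cL := continuous_laplacian hV
  have cu := hu.continuous
  have hE : Continuous fun x => Real.exp (-V x) := Real.continuous_exp.comp hV1.continuous.neg
  have hus2 : HasCompactSupport fun x => u x ^ 2 := hus.comp_left (g := fun t => t ^ 2) (by simp)
  have hcs : ∀ {f : EuclideanSpace ℝ (Fin d) → ℝ}, HasCompactSupport f →
      HasCompactSupport fun x => Real.exp (-V x) * f x := fun h => h.mul_left
  obtain ⟨Q, hQ⟩ : ∃ Q : EuclideanSpace ℝ (Fin d) → ℝ,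
      ∀ x, (‖∇ V x‖ ^ 2 - 2 * (Δ V) x) / 4 = Q x := ⟨_, fun _ => rfl⟩
  have cQ : Continuous Q :=
    (((cV.norm.pow 2).sub (continuous_const.mul cL)).div_const 4).congr hQ
  simp only [hQ] at hgs hVQ
  have iQ : Integrable fun x => Real.exp (-V x) * (u x ^ 2 * Q x) :=
    (hE.mul ((cu.pow 2).mul cQ)).integrable_of_hasCompactSupport (hcs hus2.mul_right)
  have iu : Integrable fun x => Real.exp (-V x) * u x ^ 2 :=
    (hE.mul (cu.pow 2)).integrable_of_hasCompactSupport (hcs hus2)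
  have iV : Integrable fun x => Real.exp (-V x) * (u x ^ 2 * V x) :=
    (hE.mul ((cu.pow 2).mul hV1.continuous)).integrable_of_hasCompactSupport (hcs hus2.mul_right)
  have iw : Integrable fun x => w x ^ 2 * Real.log (w x ^ 2) := by
    have hs : HasCompactSupport fun x => w x ^ 2 * Real.log (w x ^ 2) :=
      hws.comp_left (g := fun t => t ^ 2 * Real.log (t ^ 2)) (by simp)
    exact (Real.continuous_mul_log.comp (hwc.continuous.pow 2)).integrable_of_hasCompactSupport hs
  have hlog : ∀ x, Real.exp (-V x) * (u x ^ 2 * Real.log (u x ^ 2)) =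
      w x ^ 2 * Real.log (w x ^ 2) + Real.exp (-V x) * (u x ^ 2 * V x) := fun x => by
    rw [hwsq]
    by_cases hx : u x = 0
    · simp [hx]
    · rw [Real.log_mul (Real.exp_pos _).ne' (by positivity), Real.log_exp]
      ring
  have e1 : ∫ x, u x ^ 2 * Real.log (u x ^ 2) ∂(expNeg V) =
      (∫ x, w x ^ 2 * Real.log (w x ^ 2)) + ∫ x, Real.exp (-V x) * (u x ^ 2 * V x) := by
    rw [integral_expNeg hV.continuous, ← integral_add iw iV]
    exact integral_congr_ae (ae_of_all _ hlog)
  have e2 : ∫ x, Real.exp (-V x) * (u x ^ 2 * V x) ≤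
      A * (∫ x, Real.exp (-V x) * (u x ^ 2 * Q x)) +
        c * ∫ x, u x ^ 2 ∂(expNeg V) := by
    rw [integral_expNeg hV.continuous, ← integral_const_mul, ← integral_const_mul,
      ← integral_add (iQ.const_mul _) (iu.const_mul _)]
    refine integral_mono iV ((iQ.const_mul _).add (iu.const_mul _)) fun x => ?_
    have := mul_le_mul_of_nonneg_left (hVQ x)
      (show 0 ≤ Real.exp (-V x) * u x ^ 2 by positivity)
    simp only
    linarith
  rw [← integral_expNeg hV.continuous] at hgs
  rw [hN, hgs] at hls
  rw [e1]
  linarith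

/-- The defective logarithmic Sobolev inequality extends to `H¹` by Fatou's lemma. -/
theorem MemH1.defective_logSobolev [IsProbabilityMeasure (expNeg V)] (hV : Continuous V) {A B : ℝ}
    (hAB : ∀ u : EuclideanSpace ℝ (Fin d) → ℝ, ContDiff ℝ 1 u → HasCompactSupport u →
      ∫ x, u x ^ 2 * Real.log (u x ^ 2) ∂(expNeg V) ≤
        A * (∫ x, ‖∇ u x‖ ^ 2 ∂(expNeg V)) + B * (∫ x, u x ^ 2 ∂(expNeg V)) +
          (∫ x, u x ^ 2 ∂(expNeg V)) * Real.log (∫ x, u x ^ 2 ∂(expNeg V)))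
    {u : EuclideanSpace ℝ (Fin d) → ℝ} {G : EuclideanSpace ℝ (Fin d) → EuclideanSpace ℝ (Fin d)}
    (h : MemH1 (expNeg V) u G) :
    Integrable (fun x => u x ^ 2 * Real.log (u x ^ 2)) (expNeg V) ∧
      ∫ x, u x ^ 2 * Real.log (u x ^ 2) ∂(expNeg V) ≤
        A * (∫ x, ‖G x‖ ^ 2 ∂(expNeg V)) + B * (∫ x, u x ^ 2 ∂(expNeg V)) +
          (∫ x, u x ^ 2 ∂(expNeg V)) * Real.log (∫ x, u x ^ 2 ∂(expNeg V)) := by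
  obtain ⟨w', hw', hws', hwu', hwG'⟩ := h.exists_seq_tendsto hV
  have mw' : ∀ n, MemLp (w' n) 2 (expNeg V) := fun n =>
    (hw' n).continuous.memLp_of_hasCompactSupport (hws' n)
  obtain ⟨ns, hns, hae⟩ := (tendstoInMeasure_of_tendsto_eLpNorm two_ne_zero
    (fun n => (mw' n).1) h.memLp.1 hwu').exists_seq_tendsto_ae
  set w := fun n => w' (ns n)
  have hw1 : ∀ n, ContDiff ℝ 1 (w n) := fun n => (hw' (ns n)).of_le (by simp)
  have hws : ∀ n, HasCompactSupport (w n) := fun n => hws' (ns n)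
  have mw : ∀ n, MemLp (w n) 2 (expNeg V) := fun n => mw' (ns n)
  have mg : ∀ n, MemLp (∇ (w n)) 2 (expNeg V) := fun n =>
    (continuous_gradient (hw1 n)).memLp_of_hasCompactSupport (hasCompactSupport_gradient (hws n))
  have t1 := tendsto_integral_norm_sq mw h.memLp (hwu'.comp hns.tendsto_atTop)
  simp only [Real.norm_eq_abs, sq_abs] at t1
  have t2 := tendsto_integral_norm_sq mg h.memLp_grad (hwG'.comp hns.tendsto_atTop)
  have t3 := (Real.continuous_mul_log.tendsto _).comp t1
  have tR := (((t2.const_mul A).add (t1.const_mul B)).add t3).add_const 1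
  -- The added 1 makes the integrand nonnegative, as Fatou requires, and costs exactly 1 on a
  -- probability space.
  set F : ℝ → ℝ := fun t => t ^ 2 * Real.log (t ^ 2) + 1 with hF
  have hFc : Continuous F := (Real.continuous_mul_log.comp (continuous_pow 2)).add continuous_const
  have hF0 : ∀ t, 0 ≤ F t := fun t => mul_log_add_one_nonneg (sq_nonneg t)
  have iw : ∀ n, Integrable (fun x => w n x ^ 2 * Real.log (w n x ^ 2)) (expNeg V) := fun n => by
    have hs : HasCompactSupport fun x => w n x ^ 2 * Real.log (w n x ^ 2) :=
      (hws n).comp_left (g := fun t => t ^ 2 * Real.log (t ^ 2)) (by simp)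
    exact (Real.continuous_mul_log.comp
      ((hw1 n).continuous.pow 2)).integrable_of_hasCompactSupport hs
  have iFw : ∀ n, Integrable (fun x => F (w n x)) (expNeg V) := fun n =>
    (iw n).add (integrable_const 1)
  have hFw : ∀ n, ∫ x, F (w n x) ∂(expNeg V) ≤
      A * (∫ x, ‖∇ (w n) x‖ ^ 2 ∂(expNeg V)) + B * (∫ x, w n x ^ 2 ∂(expNeg V)) +
          (∫ x, w n x ^ 2 ∂(expNeg V)) * Real.log (∫ x, w n x ^ 2 ∂(expNeg V)) + 1 := fun n => by
    rw [hF, integral_add (iw n) (integrable_const 1)]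
    simpa using hAB (w n) (hw1 n) (hws n)
  have hR0 := ge_of_tendsto' tR fun n => (integral_nonneg fun x => hF0 _).trans (hFw n)
  set R := A * (∫ x, ‖G x‖ ^ 2 ∂(expNeg V)) + B * (∫ x, u x ^ 2 ∂(expNeg V)) +
          (∫ x, u x ^ 2 ∂(expNeg V)) * Real.log (∫ x, u x ^ 2 ∂(expNeg V)) with hR
  have mF : AEStronglyMeasurable (fun x => F (u x)) (expNeg V) :=
    hFc.comp_aestronglyMeasurable h.memLp.1
  have fatou : ∫⁻ x, ENNReal.ofReal (F (u x)) ∂(expNeg V) ≤ ENNReal.ofReal (R + 1) := by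
    calc _ = ∫⁻ x, liminf (fun n => ENNReal.ofReal (F (w n x))) atTop ∂(expNeg V) := by
          refine lintegral_congr_ae ?_
          filter_upwards [hae] with x hx
          exact (((ENNReal.continuous_ofReal.comp hFc).tendsto _).comp hx).liminf_eq.symm
      _ ≤ liminf (fun n => ∫⁻ x, ENNReal.ofReal (F (w n x)) ∂(expNeg V)) atTop :=
          lintegral_liminf_le' fun n =>
            (iFw n).1.aemeasurable.ennreal_ofReal
      _ ≤ liminf (fun n => ENNReal.ofReal (A * (∫ x, ‖∇ (w n) x‖ ^ 2 ∂(expNeg V)) +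
          B * (∫ x, w n x ^ 2 ∂(expNeg V)) +
          (∫ x, w n x ^ 2 ∂(expNeg V)) * Real.log (∫ x, w n x ^ 2 ∂(expNeg V)) + 1)) atTop := by
          refine liminf_le_liminf (Eventually.of_forall fun n => ?_)
          rw [← ofReal_integral_eq_lintegral_ofReal (iFw n) (ae_of_all _ fun x => hF0 _)]
          exact ENNReal.ofReal_le_ofReal (hFw n)
      _ = _ := ((ENNReal.continuous_ofReal.tendsto _).comp tR).liminf_eq
  have iF : Integrable (fun x => F (u x)) (expNeg V) :=
    ⟨mF, (hasFiniteIntegral_iff_ofReal (ae_of_all _ fun x => hF0 _)).2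
      (fatou.trans_lt ENNReal.ofReal_lt_top)⟩
  have iu : Integrable (fun x => u x ^ 2 * Real.log (u x ^ 2)) (expNeg V) :=
    (iF.sub (integrable_const 1)).congr (ae_of_all _ fun x => by simp [hF])
  refine ⟨iu, ?_⟩
  rw [← ofReal_integral_eq_lintegral_ofReal iF (ae_of_all _ fun x => hF0 _),
    ENNReal.ofReal_le_ofReal_iff hR0, hF, integral_add iu (integrable_const 1)] at fatou
  simpa using fatou

/-- Derivatives of test functions integrate to 0, so constants have zero weak gradient. Tightening
uses this for u minus its mean. -/
theorem MemH1.sub_const {u : EuclideanSpace ℝ (Fin d) → ℝ}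
    {G : EuclideanSpace ℝ (Fin d) → EuclideanSpace ℝ (Fin d)}
    {μ : Measure (EuclideanSpace ℝ (Fin d))} [IsFiniteMeasure μ] (h : MemH1 μ u G) (m : ℝ) :
    MemH1 μ (fun x => u x - m) G where
  memLp := h.memLp.sub (memLp_const m)
  memLp_grad := h.memLp_grad
  isWeakGradient :=
    { locallyIntegrable := h.isWeakGradient.locallyIntegrable.sub (locallyIntegrable_const m)
      locallyIntegrable_grad := h.isWeakGradient.locallyIntegrable_grad
      integral_eq := fun φ hφ hφs e => by
        have hφ1 : ContDiff ℝ 1 φ := hφ.of_le (by simp)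
        have c1 : Continuous fun x => fderiv ℝ φ x e :=
          (hφ1.continuous_fderiv one_ne_zero).clm_apply continuous_const
        have i1 : Integrable fun x => fderiv ℝ φ x e :=
          c1.integrable_of_hasCompactSupport (hφs.fderiv_apply ℝ e)
        have i2 : Integrable fun x => u x * fderiv ℝ φ x e := by
          have := h.isWeakGradient.locallyIntegrable.integrable_smul_right_of_hasCompactSupport
            c1 (hφs.fderiv_apply ℝ e)
          exact this
        have h0 : ∫ x, fderiv ℝ φ x e = 0 := by
          have := integral_mul_fderiv_eq_neg_fderiv_mul_of_integrable (μ := volume)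
            (f := fun _ => (1 : ℝ)) (g := φ) (v := e) (by simp) (by simpa using i1)
            (by simpa using hφ.continuous.integrable_of_hasCompactSupport hφs)
            (fun x _ => differentiableAt_const _)
            (fun x _ => hφ1.differentiable one_ne_zero x)
          simpa using this
        simp_rw [sub_mul]
        rw [integral_sub i2 (i1.const_mul m), integral_const_mul, h0, mul_zero, sub_zero,
          h.isWeakGradient.integral_eq φ hφ hφs e] }

/-- Second-order bound on the relative entropy integrand around a nonzero constant. -/
theorem sq_mul_log_sub_le (s : ℝ) :
    (|s| ≤ 1 → (1 + s) ^ 2 * Real.log ((1 + s) ^ 2) - (1 + s) ^ 2 + 1 ≤ 5 * s ^ 2) ∧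
    (1 ≤ |s| → (1 + s) ^ 2 * Real.log ((1 + s) ^ 2) - (1 + s) ^ 2 + 1 ≤
      8 * s ^ 2 + 4 * (s ^ 2 * Real.log (s ^ 2))) := by
  constructor
  · intro hs
    obtain ⟨h1, h2⟩ := abs_le.1 hs
    rcases h1.eq_or_lt with rfl | h1
    · norm_num
    -- With log(1 + s) ≤ s the constant and linear terms cancel, leaving 3s² + 2s³ ≤ 5s².
    · have hl := Real.log_le_sub_one_of_pos (show 0 < 1 + s by linarith)
      rw [Real.log_pow]
      push_cast
      nlinarith [mul_le_mul_of_nonneg_left hl (sq_nonneg (1 + s)), sq_nonneg s,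
        mul_nonneg (sq_nonneg s) (show 0 ≤ 1 - s by linarith)]
  · intro hs
    have hs2 : 1 ≤ s ^ 2 := by rw [← sq_abs]; exact one_le_pow₀ hs
    have hlog0 : 0 ≤ Real.log (s ^ 2) := Real.log_nonneg hs2
    have hy4 : (1 + s) ^ 2 ≤ 4 * s ^ 2 := by nlinarith [sq_nonneg (1 - s)]
    rcases le_total ((1 + s) ^ 2) 1 with hy | hy
    · have h1 : (1 + s) ^ 2 * Real.log ((1 + s) ^ 2) ≤ 0 :=
        mul_nonpos_of_nonneg_of_nonpos (sq_nonneg _) (Real.log_nonpos (sq_nonneg _) hy)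
      nlinarith [mul_nonneg (sq_nonneg s) hlog0, sq_nonneg (1 + s)]
    · have h1 : Real.log ((1 + s) ^ 2) ≤ Real.log 4 + Real.log (s ^ 2) := by
        rw [← Real.log_mul (by norm_num) (by linarith)]
        exact Real.log_le_log (by linarith) hy4
      have h4 : Real.log 4 ≤ 2 := by
        rw [show (4 : ℝ) = 2 ^ 2 by norm_num, Real.log_pow]
        push_cast
        linarith [Real.log_two_lt_d9]
      have h2 : (1 + s) ^ 2 * Real.log ((1 + s) ^ 2) ≤ 4 * s ^ 2 * (2 + Real.log (s ^ 2)) :=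
        mul_le_mul hy4 (by linarith) (Real.log_nonneg hy) (by positivity)
      linarith

/-- Scaling by m² reduces to s = f/m. For large s, t ≤ m² replaces log(f²/m²) by log(f²/t); the
added t keeps the bracket nonnegative, so small s obeys the same bound. In use, t is the variance.
-/
theorem add_sq_mul_log_le {m f t : ℝ} (ht : 0 < t) (htm : t ≤ m ^ 2) :
    (m + f) ^ 2 * Real.log ((m + f) ^ 2) - (m + f) ^ 2 * Real.log (m ^ 2) - (m + f) ^ 2 + m ^ 2 ≤
      8 * f ^ 2 + 4 * (f ^ 2 * Real.log (f ^ 2) - f ^ 2 * Real.log t + t) := by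
  have hm2 : 0 < m ^ 2 := ht.trans_le htm
  have hm : m ≠ 0 := by rintro rfl; simp at hm2
  obtain ⟨hsmall, hlarge⟩ := sq_mul_log_sub_le (f / m)
  have e1 : (m + f) ^ 2 = m ^ 2 * (1 + f / m) ^ 2 := by field_simp
  have e2 : f ^ 2 = m ^ 2 * (f / m) ^ 2 := by field_simp
  have lhs : (m + f) ^ 2 * Real.log ((m + f) ^ 2) - (m + f) ^ 2 * Real.log (m ^ 2) -
      (m + f) ^ 2 + m ^ 2 =
      m ^ 2 * ((1 + f / m) ^ 2 * Real.log ((1 + f / m) ^ 2) - (1 + f / m) ^ 2 + 1) := by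
    by_cases h0 : 1 + f / m = 0
    · rw [e1, h0]; simp
    · have : Real.log ((m + f) ^ 2) = Real.log (m ^ 2) + Real.log ((1 + f / m) ^ 2) := by
        rw [e1, Real.log_mul hm2.ne' (by positivity)]
      rw [this, e1]; ring
  rw [lhs]
  rcases le_total |f / m| 1 with h | h
  · have h1 := mul_le_mul_of_nonneg_left (hsmall h) hm2.le
    have h2 : 0 ≤ f ^ 2 * Real.log (f ^ 2) - f ^ 2 * Real.log t + t := by
      by_cases hf : f = 0
      · simp [hf, ht.le]
      · have h3 := mul_nonneg ht.le (mul_log_add_one_nonneg (show 0 ≤ f ^ 2 / t by positivity))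
        rw [Real.log_div (by positivity) ht.ne'] at h3
        have h4 : t * (f ^ 2 / t * (Real.log (f ^ 2) - Real.log t) + 1) =
            f ^ 2 * Real.log (f ^ 2) - f ^ 2 * Real.log t + t := by field_simp
        linarith
    have h5 : m ^ 2 * (5 * (f / m) ^ 2) = 5 * f ^ 2 := by rw [e2]; ring
    nlinarith [sq_nonneg f]
  · have h1 := mul_le_mul_of_nonneg_left (hlarge h) hm2.le
    have hf : f ≠ 0 := by
      rintro rfl
      simp at h
      linarith
    have hl : Real.log ((f / m) ^ 2) ≤ Real.log (f ^ 2) - Real.log t := by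
      rw [div_pow, Real.log_div (by positivity) hm2.ne']
      linarith [Real.log_le_log ht htm]
    have h2 : m ^ 2 * (8 * (f / m) ^ 2 + 4 * ((f / m) ^ 2 * Real.log ((f / m) ^ 2))) =
        8 * f ^ 2 + 4 * (f ^ 2 * Real.log ((f / m) ^ 2)) := by rw [e2]; ring
    have h3 := mul_le_mul_of_nonneg_left hl (sq_nonneg f)
    linarith

/-- A defective logarithmic Sobolev inequality together with a Poincaré inequality gives a tight
logarithmic Sobolev inequality. -/
theorem logSobolev_of_defective_of_poincare {μ : Measure (EuclideanSpace ℝ (Fin d))}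
    [IsProbabilityMeasure μ] {A B P : ℝ} (hA : 0 ≤ A) (hB : 0 ≤ B) (hP : 0 ≤ P)
    (hdef : ∀ u G, MemH1 μ u G → Integrable (fun x => u x ^ 2 * Real.log (u x ^ 2)) μ ∧
      ∫ x, u x ^ 2 * Real.log (u x ^ 2) ∂μ ≤ A * (∫ x, ‖G x‖ ^ 2 ∂μ) + B * (∫ x, u x ^ 2 ∂μ) +
          (∫ x, u x ^ 2 ∂μ) * Real.log (∫ x, u x ^ 2 ∂μ))
    (hpoin : ∀ u G, MemH1 μ u G →
      (∫ x, u x ^ 2 ∂μ) - (∫ x, u x ∂μ) ^ 2 ≤ P * ∫ x, ‖G x‖ ^ 2 ∂μ) :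
    LogSobolev μ := by
  refine ⟨4 * A + (4 * B + 12) * P, fun u G h => ?_⟩
  have hpu := hpoin u G h
  have hD : 0 ≤ ∫ x, ‖G x‖ ^ 2 ∂μ := integral_nonneg fun x => by positivity
  obtain ⟨iu, hu⟩ := hdef u G h
  have iu2 : Integrable (fun x => u x ^ 2) μ := h.memLp.integrable_sq
  have hN0 : 0 ≤ ∫ x, u x ^ 2 ∂μ := integral_nonneg fun x => sq_nonneg _
  set m := ∫ x, u x ∂μ with hm
  have hf := h.sub_const m
  obtain ⟨ifl, hfl⟩ := hdef _ G hf
  have if2 : Integrable (fun x => (u x - m) ^ 2) μ := hf.memLp.integrable_sq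
  have hvar := variance_expand h.memLp m
  simp only [Real.norm_eq_abs, sq_abs] at hvar
  rw [← hm] at hvar
  set N := ∫ x, u x ^ 2 ∂μ with hN
  set D := ∫ x, ‖G x‖ ^ 2 ∂μ
  set T := ∫ x, (u x - m) ^ 2 ∂μ with hT
  have hT0 : 0 ≤ T := integral_nonneg fun x => sq_nonneg _
  have hTN : T = N - m ^ 2 := by rw [hvar]; ring
  have hTP : T ≤ P * D := by rw [hTN]; exact hpu
  have hC0 : 0 ≤ (4 * A + (4 * B + 12) * P) * D := by positivity
  rcases hN0.eq_or_lt with hN0 | hNpos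
  · rw [← hN0]
    simpa using hC0
  have hlogdiv : ∀ x, u x ^ 2 * Real.log (u x ^ 2 / N) =
      u x ^ 2 * Real.log (u x ^ 2) - u x ^ 2 * Real.log N := fun x => by
    by_cases hx : u x = 0
    · simp [hx]
    · rw [Real.log_div (by positivity) hNpos.ne']; ring
  simp_rw [hlogdiv]
  have iuN : Integrable (fun x => u x ^ 2 * Real.log N) μ := iu2.mul_const _
  refine ⟨iu.sub iuN, ?_⟩
  rw [integral_sub iu iuN, integral_mul_const, ← hN]
  have hAD : 0 ≤ A * D := by positivity
  have hPD : 0 ≤ P * D := by positivity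
  have hBT : B * T ≤ B * (P * D) := mul_le_mul_of_nonneg_left hTP hB
  have hBPD : 0 ≤ B * (P * D) := by positivity
  -- If the squared mean is below the variance, then N = T + m² < 2T and the defect BN is already at
  -- most 2BP·D.
  rcases lt_or_ge (m ^ 2) T with hmT | hmT
  · have h2 : B * N ≤ B * (2 * T) := mul_le_mul_of_nonneg_left (by linarith) hB
    linarith
  have hm2 : 0 < m ^ 2 := by
    by_contra hcon
    have : m ^ 2 = 0 := le_antisymm (not_lt.1 hcon) (sq_nonneg m)
    linarith
  -- Hence the entropy is at most ∫ (u² log(u²/m²) - u² + m²) dμ, which is of second order in u - m.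
  have hNm : N * Real.log (m ^ 2) + N - m ^ 2 ≤ N * Real.log N := by
    have h1 := Real.one_sub_inv_le_log_of_pos (show 0 < N / m ^ 2 by positivity)
    rw [Real.log_div hNpos.ne' hm2.ne', inv_div] at h1
    have h2 := mul_le_mul_of_nonneg_left h1 hNpos.le
    have h3 : N * (1 - m ^ 2 / N) = N - m ^ 2 := by field_simp
    rw [h3] at h2
    linarith
  have iL : Integrable (fun x => u x ^ 2 * Real.log (u x ^ 2) - u x ^ 2 * Real.log (m ^ 2) -
      u x ^ 2 + m ^ 2) μ :=
    ((iu.sub (iu2.mul_const _)).sub iu2).add (integrable_const _)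
  have eL : ∫ x, (u x ^ 2 * Real.log (u x ^ 2) - u x ^ 2 * Real.log (m ^ 2) -
      u x ^ 2 + m ^ 2) ∂μ =
      (∫ x, u x ^ 2 * Real.log (u x ^ 2) ∂μ) - N * Real.log (m ^ 2) - N + m ^ 2 := by
    have j1 : Integrable (fun x => u x ^ 2 * Real.log (u x ^ 2) - u x ^ 2 * Real.log (m ^ 2)) μ :=
      iu.sub (iu2.mul_const _)
    have j2 : Integrable (fun x => u x ^ 2 * Real.log (u x ^ 2) - u x ^ 2 * Real.log (m ^ 2) -
      u x ^ 2) μ := j1.sub iu2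
    rw [integral_add j2 (integrable_const _), integral_sub j1 iu2,
      integral_sub iu (iu2.mul_const _), integral_mul_const, integral_const]
    simp [hN]
  suffices hbound : ∫ x, (u x ^ 2 * Real.log (u x ^ 2) - u x ^ 2 * Real.log (m ^ 2) -
      u x ^ 2 + m ^ 2) ∂μ ≤ 12 * T + 4 * (A * D + B * T) by
    linarith
  rcases hT0.eq_or_lt with hT0 | hTpos
  · have hae := (integral_eq_zero_iff_of_nonneg (fun x => sq_nonneg (u x - m)) if2).1 hT0.symm
    have : ∫ x, (u x ^ 2 * Real.log (u x ^ 2) - u x ^ 2 * Real.log (m ^ 2) -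
      u x ^ 2 + m ^ 2) ∂μ = 0 := by
      refine integral_eq_zero_of_ae ?_
      filter_upwards [hae] with x hx
      have : u x = m := by simpa [sub_eq_zero] using hx
      simp [this]
    rw [this, ← hT0]
    linarith
  have iR : Integrable (fun x => (u x - m) ^ 2 * Real.log ((u x - m) ^ 2) -
      (u x - m) ^ 2 * Real.log T) μ := ifl.sub (if2.mul_const _)
  have iR2 : Integrable (fun x => (u x - m) ^ 2 * Real.log ((u x - m) ^ 2) -
      (u x - m) ^ 2 * Real.log T + T) μ := iR.add (integrable_const _)
  -- With t = T, the T log T here cancels the one in the defective inequality for u - m. The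
  -- remaining 8T + 4T is the source of the 12 in the constant.
  calc _ ≤ ∫ x, (8 * (u x - m) ^ 2 + 4 * ((u x - m) ^ 2 * Real.log ((u x - m) ^ 2) -
        (u x - m) ^ 2 * Real.log T + T)) ∂μ := by
        refine integral_mono iL ((if2.const_mul 8).add (iR2.const_mul 4)) fun x => ?_
        have := add_sq_mul_log_le (m := m) (f := u x - m) hTpos hmT
        simpa only [add_sub_cancel] using this
    _ = 8 * T + 4 * ((∫ x, (u x - m) ^ 2 * Real.log ((u x - m) ^ 2) ∂μ) - T * Real.log T + T) := by
        rw [integral_add (if2.const_mul 8) (iR2.const_mul 4), integral_const_mul,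
          integral_const_mul, integral_add iR (integrable_const _),
          integral_sub ifl (if2.mul_const _), integral_mul_const, integral_const]
        simp [hT]
    _ ≤ _ := by linarith

end LogSobolev

/-! ### Essential boundedness with respect to the Gaussian -/

section Gaussian

theorem absolutelyContinuous_gaussian (d : ℕ) {σ : ℝ} (hσ : 0 < σ) :
    (volume : Measure (EuclideanSpace ℝ (Fin d))) ≪ gaussian d σ := by
  refine withDensity_absolutelyContinuous' ?_ (ae_of_all _ fun x => ?_)
  · refine (Continuous.measurable ?_).ennreal_ofReal.aemeasurable
    fun_prop
  · have : 0 < (2 * Real.pi * σ ^ 2) ^ (-(d : ℝ) / 2) * Real.exp (-‖x‖ ^ 2 / (2 * σ ^ 2)) := by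
      have := Real.pi_pos
      positivity
    simpa using this

/-- Lebesgue measure is absolutely continuous with respect to the Gaussian, so {W > M} is
Lebesgue-null; being open, it is empty. -/
theorem exists_le_of_memLp_top_gaussian {d : ℕ} {σ : ℝ} (hσ : 0 < σ)
    {W : EuclideanSpace ℝ (Fin d) → ℝ} (hWc : Continuous W) (hW : MemLp W ⊤ (gaussian d σ)) :
    ∃ M : ℝ, ∀ x, W x ≤ M := by
  have htop := hW.eLpNorm_ne_top
  rw [eLpNorm_exponent_top] at htop
  set M := (eLpNormEssSup W (gaussian d σ)).toReal with hM
  refine ⟨M, fun x => ?_⟩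
  have hae : ∀ᵐ x ∂(volume : Measure (EuclideanSpace ℝ (Fin d))), W x ≤ M := by
    have h1 : ∀ᵐ x ∂(gaussian d σ), W x ≤ M := by
      filter_upwards [enorm_ae_le_eLpNormEssSup W (gaussian d σ)] with x hx
      have := ENNReal.toReal_mono htop hx
      rw [toReal_enorm] at this
      exact (le_abs_self _).trans this
    exact (absolutelyContinuous_gaussian d hσ).ae_le h1
  by_contra hx
  have hopen : IsOpen {x | M < W x} := isOpen_lt continuous_const hWc
  have hnull : volume {x | M < W x} = 0 := by
    have : {x | M < W x} = {x | ¬ W x ≤ M} := by ext; simp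
    rw [this]; exact hae
  have := hopen.eq_empty_of_measure_zero hnull
  exact (this ▸ (show x ∈ {x | M < W x} from not_le.1 hx) : x ∈ (∅ : Set _))

end Gaussian

end ConvexSobolev

/-! ### Conclusion -/

theorem corollary5 (d : ℕ) (V : EuclideanSpace ℝ (Fin d) → ℝ) (hV : ContDiff ℝ 2 V)
    (hμ : IsProbabilityMeasure (ConvexSobolev.expNeg V))
    (p : ℝ) (hp : p ∈ Set.Ico (1 : ℝ) 2)
    (p' : ℝ≥0∞) (hpp' : ENNReal.HolderConjugate (ENNReal.ofReal p) p')
    (hσ : ∃ σ : ℝ, 0 < σ ∧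
      MemLp (fun x => V x - ‖x‖ ^ 2 / (2 * σ ^ 2)) p' (ConvexSobolev.gaussian d σ) ∧
      BddBelow (Set.range fun x => ‖∇ V x‖ ^ 2 - 2 * (Δ V) x - ‖x‖ ^ 2 / σ ^ 4)) :
    (p = 1 → ConvexSobolev.LogSobolev (ConvexSobolev.expNeg V)) ∧
      (1 < p → ConvexSobolev.GeneralizedPoincare p (ConvexSobolev.expNeg V)) := by
  obtain ⟨σ, hσ0, hW, b, hb⟩ := hσ
  have hQ : ∀ x, 1 / (4 * σ ^ 4) * ‖x‖ ^ 2 - (-b / 4) ≤ (‖∇ V x‖ ^ 2 - 2 * (Δ V) x) / 4 := by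
    intro x
    have h1 : b ≤ ‖∇ V x‖ ^ 2 - 2 * (Δ V) x - ‖x‖ ^ 2 / σ ^ 4 := hb (Set.mem_range_self x)
    have h2 : 1 / (4 * σ ^ 4) * ‖x‖ ^ 2 = (‖x‖ ^ 2 / σ ^ 4) / 4 := by field_simp
    rw [h2]
    linarith
  obtain ⟨P, hP0, hP⟩ := ConvexSobolev.exists_poincare hV (by positivity) hQ
  refine ⟨?_, fun hp1 => ConvexSobolev.generalizedPoincare_of_poincare hP hp1 hp.2.le⟩
  rintro rfl
  have hp' : p' = ⊤ := by
    have h := hpp'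
    rw [ENNReal.ofReal_one] at h
    have h1 := ENNReal.HolderConjugate.inv_add_inv_eq_one 1 p'
    have h2 : (1 : ℝ≥0∞) + p'⁻¹ = 1 + 0 := by simpa using h1
    exact ENNReal.inv_eq_zero.1 ((ENNReal.add_right_inj ENNReal.one_ne_top).1 h2)
  rw [hp'] at hW
  obtain ⟨M, hM⟩ := ConvexSobolev.exists_le_of_memLp_top_gaussian hσ0
    (hV.continuous.sub (by fun_prop)) hW
  -- The factor 2σ² turns the lower bound |x|²/(4σ⁴) on Q into exactly |x|²/(2σ²), the quadratic
  -- part of V; it fixes the gradient constant required of the Euclidean inequality.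
  have hVQ : ∀ x, V x ≤ (2 * σ ^ 2) * ((‖∇ V x‖ ^ 2 - 2 * (Δ V) x) / 4) +
      (M - (2 * σ ^ 2) * (b / 4)) := by
    intro x
    have h1 := mul_le_mul_of_nonneg_left (hQ x) (show 0 ≤ 2 * σ ^ 2 by positivity)
    have h2 : 2 * σ ^ 2 * (1 / (4 * σ ^ 4) * ‖x‖ ^ 2 - (-b / 4)) =
        ‖x‖ ^ 2 / (2 * σ ^ 2) + 2 * σ ^ 2 * (b / 4) := by
      field_simp
      ring
    have h3 : V x - ‖x‖ ^ 2 / (2 * σ ^ 2) ≤ M := hM x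
    linarith
  obtain ⟨B, hB⟩ := ConvexSobolev.exists_defective_logSobolev_of_hasCompactSupport hV
    (show 0 < 2 * σ ^ 2 by positivity) hVQ
  -- Tightening needs a nonnegative defect, hence `max B 0`.
  refine ConvexSobolev.logSobolev_of_defective_of_poincare (A := 2 * σ ^ 2) (B := max B 0)
    (by positivity) (le_max_right _ _) hP0 (fun u G h => ?_) hP
  obtain ⟨h1, h2⟩ := h.defective_logSobolev hV.continuous hB
  refine ⟨h1, h2.trans ?_⟩
  have hN : 0 ≤ ∫ x, u x ^ 2 ∂(ConvexSobolev.expNeg V) := integral_nonneg fun x => sq_nonneg (u x)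
  gcongr
  exact le_max_left _ _
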